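/- **Setting.** QPT means: a family of quantum circuits (one for each security parameter $n$) whose descriptions are computed from $1^n$ in classical polynomial time. A function $\nu:\mathbb N\to\mathbb R$ is negligible if $n^k\nu(n)\to 0$ for every $k$. A quantum signature scheme $\Pi=(\mathsf{KeyGen},\mathsf{Sign},\mathsf{Ver})$ consists of QPT algorithms: $\mathsf{KeyGen}(1^n)$ outputs a classical key pair $(\mathsf{sk},\mathsf{vk})$; $\mathsf{Sign}_{\mathsf{sk}}$ is a channel from the message register $M$ to a register $C$; $\mathsf{Ver}_{\mathsf{vk}}$ is a channel from $C$ to $\mathcal H_M\oplus\mathbb C|\bot\rangle$, where $\bot$ means "reject"; all registers have $\mathrm{poly}(n)$ (qu)bits. $\|\cdot\|_\diamond$ is the unnormalised diamond norm (two channels are at distance at most $2$). * $\Pi$ is *correct* if there is a negligible $\nu$ with $\|\mathsf{Ver}_{\mathsf{vk}}\circ\mathsf{Sign}_{\mathsf{sk}}-\mathrm{id}_M\oplus 0_\bot\|_\diamond\le\nu(n)$ for all $n$ and all $(\mathsf{sk},\mathsf{vk})$ that $\mathsf{KeyGen}(1^n)$ outputs with positive probability. * A *two-outcome measurement* is a family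 of projectors $P=P_n$ on $\mathcal H_M\oplus\mathbb C|\bot\rangle$ with the measurement channel $L(X)=\mathrm{Tr}((\mathbb 1-P)X)|0\rangle\langle 0|+\mathrm{Tr}(PX)|1\rangle\langle 1|$. It is *non-trivial* if there are efficiently preparable (QPT) message states $\rho_0,\rho_1$ on which, up to negligible error, it returns the outcome $0$ respectively $1$ with certainty. * For $\varepsilon:\mathbb N\to[0,\infty)$ and a set $\mathcal L$ of two-outcome measurements, $\Pi$ is *$\varepsilon$-one-time $\mathcal L$-secure* if for every QPT adversary $\mathcal A$ (a channel on $C$ that also receives $\mathsf{vk}$) and every $L\in\mathcal L$ there are probabilities $p=p(n)\in[0,1]$ such that, for all $n$, $$\bigl\|L\circ\mathbb E\bigl[\mathsf{Ver}_{\mathsf{vk}}\circ\mathcal A(\mathsf{vk})\circ\mathsf{Sign}_{\mathsf{sk}}\bigr]-\bigl(p\,L+(1-p)\,L\circ\bot\bigr)\bigr\|_\diamond\le\varepsilon(n),$$ where the expectation is over $(\mathsf{sk},\mathsf{vk})\leftarrow\mathsf{KeyGen}(1^n)$, the $L$ in $p\,L$ acts on the message in $\mathcal H_M\subset\mathcal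 H_M\oplus\mathbb C|\bot\rangle$, and $\bot$ denotes the reject map $X\mapsto\mathrm{Tr}(X)|\bot\rangle\langle\bot|$. **Theorem.** Let $\Pi$ be a correct quantum signature scheme and let $M$ be a non-trivial two-outcome measurement. Then $\Pi$ is at most $(1-\mathrm{negl}(n))$-one-time $\{M\}$-secure: there is a negligible function $\nu$ such that, whenever $\Pi$ is $\varepsilon$-one-time $\{M\}$-secure, $\varepsilon(n)\ge 1-\nu(n)$ for all $n$. Moreover, for all $n$ at which $M$ has a deterministic outcome on the reject state $|\bot\rangle$, even $\varepsilon(n)\ge 2-\nu(n)$ (i.e. $1-\nu(n)/2$ if the diamond norm is normalised so that channels have distance at most $1$). -/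

import Mathlib

open scoped ENNReal NNReal Matrix

/-! ### Polynomial time

Programs of a machine with finitely many stacks of bits (equivalently, up to constant factors in the
running time, a multi-tape Turing machine), written in structured form. -/

/-- Programs over stacks of bits, the stacks being addressed by natural numbers. A program
mentions only finitely many stacks. -/
inductive Prog : Type
  | push (b : Bool) (r : ℕ)
  | pop (r : ℕ)
  | seq (p q : Prog)
  /-- inspect the top of stack `r`: run `p` if it is `true`, `q` if it is `false`, and `e` if the
  stack is empty -/
  | branch (r : ℕ) (p q e : Prog)
  /-- run `p` again and again while stack `r` is non-empty -/
  | loop (r : ℕ) (p : Prog)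

/-- `p.Runs s t s'`: started on the stack contents `s`, the program `p` halts after exactly `t`
elementary steps (pushes, pops and tests), leaving the stack contents `s'`. -/
inductive Prog.Runs : Prog → (ℕ → List Bool) → ℕ → (ℕ → List Bool) → Prop
  | push (b : Bool) (r : ℕ) (s : ℕ → List Bool) :
      Prog.Runs (.push b r) s 1 (Function.update s r (b :: s r))
  | pop (r : ℕ) (s : ℕ → List Bool) :
      Prog.Runs (.pop r) s 1 (Function.update s r (s r).tail)
  | seq {p q : Prog} {s s' s'' : ℕ → List Bool} {t t' : ℕ} :
      Prog.Runs p s t s' → Prog.Runs q s' t' s'' → Prog.Runs (.seq p q) s (t + t') s''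
  | branch_true {r : ℕ} {p q e : Prog} {s s' : ℕ → List Bool} {t : ℕ} :
      (s r).head? = some true → Prog.Runs p s t s' → Prog.Runs (.branch r p q e) s (t + 1) s'
  | branch_false {r : ℕ} {p q e : Prog} {s s' : ℕ → List Bool} {t : ℕ} :
      (s r).head? = some false → Prog.Runs q s t s' → Prog.Runs (.branch r p q e) s (t + 1) s'
  | branch_empty {r : ℕ} {p q e : Prog} {s s' : ℕ → List Bool} {t : ℕ} :
      s r = [] → Prog.Runs e s t s' → Prog.Runs (.branch r p q e) s (t + 1) s'
  | loop_done {r : ℕ} {p : Prog} {s : ℕ → List Bool} :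
      s r = [] → Prog.Runs (.loop r p) s 1 s
  | loop_step {r : ℕ} {p : Prog} {s s' s'' : ℕ → List Bool} {t t' : ℕ} :
      s r ≠ [] → Prog.Runs p s t s' → Prog.Runs (.loop r p) s' t' s'' →
      Prog.Runs (.loop r p) s (t + t' + 1) s''

/-- The bit string `f n` can be computed from `1ⁿ` in time polynomial in `n`: the input is
on stack `0`, all other stacks are empty at the start, and the output is left on stack `1`. -/
def PolyTimeComputable (f : ℕ → List Bool) : Prop :=
  ∃ (p : Prog) (T : Polynomial ℕ), ∀ n : ℕ, ∃ (t : ℕ) (s : ℕ → List Bool),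
    t ≤ T.eval n ∧
    p.Runs (Function.update (fun _ => []) 0 (List.replicate n true)) t s ∧ s 1 = f n

/-! ### Quantum circuits -/

/-- Labels of the computational basis of `w` qubits (also: classical strings of `w` bits). -/
abbrev Qubits (w : ℕ) : Type := Fin w → Bool

/-- The universal gate set `H`, `T`, `T†`, `CNOT`, on `w` wires. -/
inductive Gate (w : ℕ) : Type
  | had (i : Fin w)
  | tee (i : Fin w)
  | teeDag (i : Fin w)
  /-- control `i`, target `j` -/
  | cnot (i j : Fin w) (hij : i ≠ j)

/-- The unitary matrix of a gate. -/
noncomputable def Gate.matrix {w : ℕ} : Gate w → Matrix (Qubits w) (Qubits w) ℂ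
  | .had i => Matrix.of fun x y =>
      if ∀ j, j ≠ i → x j = y j then
        (if x i = true ∧ y i = true then -1 else 1) / (Real.sqrt 2 : ℂ)
      else 0
  | .tee i => Matrix.diagonal fun x =>
      if x i = true then Complex.exp (Real.pi / 4 * Complex.I) else 1
  | .teeDag i => Matrix.diagonal fun x =>
      if x i = true then Complex.exp (-(Real.pi / 4 * Complex.I)) else 1
  | .cnot i j _ => Matrix.of fun x y =>
      if x = Function.update y j (xor (y i) (y j)) then 1 else 0

/-- The unitary matrix of a list of gates; the head of the list is applied first. -/
noncomputable def gatesMatrix {w : ℕ} : List (Gate w) → Matrix (Qubits w) (Qubits w) ℂ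
  | [] => 1
  | g :: gs => gatesMatrix gs * g.matrix

/-- A quantum circuit that takes `a` qubits and `k` classical bits as input and outputs `b` qubits.
Wires `0, …, a - 1` carry the quantum input, wires `a, …, a + k - 1` the classical input, and
all further wires start in the state `|0⟩`. At the end all wires but `0, …, b - 1` are discarded. -/
structure QCircuit (a k b : ℕ) : Type where
  wires : ℕ
  input_le : a + k ≤ wires
  output_le : b ≤ wires
  gates : List (Gate wires)

/-- The number `k` in unary, with an end marker. -/
def unaryBits (k : ℕ) : List Bool := List.replicate k true ++ [false]

def Gate.encode {w : ℕ} : Gate w → List Bool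
  | .had i => [false, false] ++ unaryBits i
  | .tee i => [false, true] ++ unaryBits i
  | .teeDag i => [true, false] ++ unaryBits i
  | .cnot i j _ => [true, true] ++ unaryBits i ++ unaryBits j

/-- The description of a circuit as a bit string. -/
def QCircuit.encode {a k b : ℕ} (C : QCircuit a k b) : List Bool :=
  unaryBits a ++ unaryBits k ++ unaryBits b ++ unaryBits C.wires ++ C.gates.flatMap Gate.encode

/-- Quantum polynomial time: a family of circuits, one for each value `n` of the security
parameter, whose descriptions are computed from `1ⁿ` in polynomial time. -/
def IsQPT {a k b : ℕ → ℕ} (C : ∀ n, QCircuit (a n) (k n) (b n)) : Prop :=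
  PolyTimeComputable fun n => (C n).encode

/-- The basis state of all wires at the start: quantum input `y`, classical input `key`, zeros. -/
def initialState {a k : ℕ} (w : ℕ) (key : Qubits k) (y : Qubits a) : Qubits w := fun i =>
  if h : i.val < a then y ⟨i.val, h⟩
  else if h' : i.val - a < k then key ⟨i.val - a, h'⟩
  else false

/-- The basis state of `w` wires with `y` on the first `b` wires and `e` on the others. -/
def joinWires {b w : ℕ} (y : Qubits b) (e : Qubits (w - b)) : Qubits w := fun i =>
  if h : i.val < b then y ⟨i.val, h⟩ else e ⟨i.val - b, by omega⟩

/-- Keep the first `b` of `w` qubits and trace out the others. -/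
noncomputable def keepFirst (w b : ℕ) :
    Matrix (Qubits w) (Qubits w) ℂ →ₗ[ℂ] Matrix (Qubits b) (Qubits b) ℂ where
  toFun ρ := Matrix.of fun y y' => ∑ e : Qubits (w - b), ρ (joinWires y e) (joinWires y' e)
  map_add' ρ σ := by ext y y'; simp [Finset.sum_add_distrib]
  map_smul' z ρ := by ext y y'; simp [Finset.mul_sum]

/-- The map `X ↦ V X V†`. -/
noncomputable def conjBy {A B : Type*} [Fintype A] [Fintype B] (V : Matrix B A ℂ) :
    Matrix A A ℂ →ₗ[ℂ] Matrix B B ℂ where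
  toFun X := V * X * Vᴴ
  map_add' X Y := by rw [Matrix.mul_add, Matrix.add_mul]
  map_smul' z X := by simp

/-- The isometry that adds the classical input and the ancillas and then applies the gates. -/
noncomputable def QCircuit.isometry {a k b : ℕ} (C : QCircuit a k b) (key : Qubits k) :
    Matrix (Qubits C.wires) (Qubits a) ℂ :=
  Matrix.of fun x y => gatesMatrix C.gates x (initialState C.wires key y)

/-- The quantum channel implemented by a circuit with classical input `key`. -/
noncomputable def QCircuit.channel {a k b : ℕ} (C : QCircuit a k b) (key : Qubits k) :
    Matrix (Qubits a) (Qubits a) ℂ →ₗ[ℂ] Matrix (Qubits b) (Qubits b) ℂ :=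
  keepFirst C.wires b ∘ₗ conjBy (C.isometry key)

/-- The output state of a circuit without input. -/
noncomputable def QCircuit.outputState {b : ℕ} (C : QCircuit 0 0 b) :
    Matrix (Qubits b) (Qubits b) ℂ :=
  C.channel Fin.elim0 1

/-! ### Norms -/

/-- The trace norm `Tr √(X† X)`, the sum of the singular values. -/
noncomputable def traceNorm {A : Type*} [Fintype A] [DecidableEq A] (X : Matrix A A ℂ) : ℝ :=
  ∑ i, Real.sqrt ((Matrix.isHermitian_conjTranspose_mul_self X).eigenvalues i)

/-- `Φ ⊗ id_R` for a reference system `R`. -/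
def tensorId {A B : Type*} (R : Type*) (Φ : Matrix A A ℂ →ₗ[ℂ] Matrix B B ℂ)
    (X : Matrix (A × R) (A × R) ℂ) : Matrix (B × R) (B × R) ℂ :=
  Matrix.of fun u v => Φ (Matrix.of fun x y => X (x, u.2) (y, v.2)) u.1 v.1

/-- The diamond norm `sup_R sup { ‖(Φ ⊗ id_R)(X)‖₁ : ‖X‖₁ ≤ 1 }`, in the convention in which the
distance of two channels is at most `2`. -/
noncomputable def diamondNorm {A B : Type*} [Fintype A] [DecidableEq A] [Fintype B] [DecidableEq B]
    (Φ : Matrix A A ℂ →ₗ[ℂ] Matrix B B ℂ) : ℝ≥0∞ :=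
  ⨆ (d : ℕ) (X : Matrix (A × Fin d) (A × Fin d) ℂ) (_ : traceNorm X ≤ 1),
    ENNReal.ofReal (traceNorm (tensorId (Fin d) Φ X))

/-- Negligible functions: `nᵏ ν(n) → 0` for every `k`. -/
def Negligible (ν : ℕ → ℝ) : Prop :=
  Asymptotics.SuperpolynomialDecay Filter.atTop (fun n : ℕ => (n : ℝ)) ν

/-! ### The space `H_M ⊕ ℂ|⊥⟩`

Its basis is `Option (Qubits m)`, with `none` for `⊥`. -/

/-- `id_M ⊕ 0_⊥`: a message state as a state of `H_M ⊕ ℂ|⊥⟩`. -/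
noncomputable def acceptMap (m : ℕ) : Matrix (Qubits m) (Qubits m) ℂ →ₗ[ℂ]
    Matrix (Option (Qubits m)) (Option (Qubits m)) ℂ :=
  conjBy (Matrix.of fun u y => if u = some y then 1 else 0)

/-- The reject map `X ↦ Tr(X) |⊥⟩⟨⊥|`. -/
noncomputable def rejectMap (m : ℕ) : Matrix (Qubits m) (Qubits m) ℂ →ₗ[ℂ]
    Matrix (Option (Qubits m)) (Option (Qubits m)) ℂ :=
  (Matrix.traceLinearMap (Qubits m) ℂ ℂ).smulRight (Matrix.single none none 1)

/-- How `1 + m` output qubits (a reject flag and a message register) represent a state of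
`H_M ⊕ ℂ|⊥⟩`: `|0⟩|y⟩` is the message `|y⟩` and `|1⟩|z⟩` is `⊥`. The map applies the isometry
`|0⟩|y⟩ ↦ |y⟩ ⊗ |0…0⟩`, `|1⟩|z⟩ ↦ |⊥⟩ ⊗ |z⟩` and discards the second factor, so that coherence
between messages and `⊥` is possible; a circuit that wants a classical flag copies it to an
ancilla by a `CNOT`. -/
noncomputable def readFlag (m : ℕ) : Matrix (Qubits (m + 1)) (Qubits (m + 1)) ℂ →ₗ[ℂ]
    Matrix (Option (Qubits m)) (Option (Qubits m)) ℂ :=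
  ∑ z : Qubits m, conjBy (Matrix.of fun u (x : Qubits (m + 1)) =>
    match u with
    | some y => if x = Fin.cons false y ∧ z = (fun _ => false) then 1 else 0
    | none => if x = Fin.cons true z then 1 else 0)

/-- A two-outcome measurement on the space with basis `A`, given by a projector. -/
structure TwoOutcome (A : Type) [Fintype A] : Type where
  P : Matrix A A ℂ
  isProj : IsStarProjection P

/-- The measurement channel `X ↦ Tr((1 - P) X) |0⟩⟨0| + Tr(P X) |1⟩⟨1|`. -/
noncomputable def TwoOutcome.channel {A : Type} [Fintype A] [DecidableEq A] (L : TwoOutcome A) :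
    Matrix A A ℂ →ₗ[ℂ] Matrix (Fin 2) (Fin 2) ℂ :=
  (Matrix.traceLinearMap A ℂ ℂ ∘ₗ LinearMap.mulLeft ℂ (1 - L.P)).smulRight (Matrix.single 0 0 1) +
  (Matrix.traceLinearMap A ℂ ℂ ∘ₗ LinearMap.mulLeft ℂ L.P).smulRight (Matrix.single 1 1 1)

/-! ### Quantum signature schemes -/

/-- A quantum signature scheme: QPT algorithms `KeyGen`, `Sign`, `Ver`, for messages of `m n` qubits,
signed messages of `c n` qubits, signing keys of `s n` bits and verification keys of `v n` bits.
`KeyGen` outputs the signing key followed by the verification key. -/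
structure QSignature : Type where
  m : ℕ → ℕ
  c : ℕ → ℕ
  s : ℕ → ℕ
  v : ℕ → ℕ
  keyGen : ∀ n, QCircuit 0 0 (s n + v n)
  sign : ∀ n, QCircuit (m n) (s n) (c n)
  ver : ∀ n, QCircuit (c n) (v n) (m n + 1)
  keyGen_qpt : IsQPT keyGen
  sign_qpt : IsQPT sign
  ver_qpt : IsQPT ver

namespace QSignature

/-- The probability that `KeyGen(1ⁿ)` outputs `(sk, vk)`. -/
noncomputable def keyProb (S : QSignature) (n : ℕ) (sk : Qubits (S.s n)) (vk : Qubits (S.v n)) : ℝ :=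
  ((S.keyGen n).outputState (Fin.append sk vk) (Fin.append sk vk)).re

/-- `Ver_vk`, a channel to `H_M ⊕ ℂ|⊥⟩`. -/
noncomputable def verChannel (S : QSignature) (n : ℕ) (vk : Qubits (S.v n)) :
    Matrix (Qubits (S.c n)) (Qubits (S.c n)) ℂ →ₗ[ℂ]
      Matrix (Option (Qubits (S.m n))) (Option (Qubits (S.m n))) ℂ :=
  readFlag (S.m n) ∘ₗ (S.ver n).channel vk

/-- (Full) correctness: `‖Ver_vk ∘ Sign_sk - id_M ⊕ 0_⊥‖_⋄ ≤ negl(n)` for all possible outputs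
`(sk, vk)` of `KeyGen(1ⁿ)`. -/
def Correct (S : QSignature) : Prop :=
  ∃ ν : ℕ → ℝ, Negligible ν ∧ ∀ (n : ℕ) (sk : Qubits (S.s n)) (vk : Qubits (S.v n)),
    0 < S.keyProb n sk vk →
      diamondNorm (S.verChannel n vk ∘ₗ (S.sign n).channel sk - acceptMap (S.m n))
        ≤ ENNReal.ofReal (ν n)

/-- The averaged effect `𝔼[Ver_vk ∘ 𝒜(vk) ∘ Sign_sk]` of an adversary `𝒜`. -/
noncomputable def attackMap (S : QSignature) (n : ℕ) (adv : QCircuit (S.c n) (S.v n) (S.c n)) :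
    Matrix (Qubits (S.m n)) (Qubits (S.m n)) ℂ →ₗ[ℂ]
      Matrix (Option (Qubits (S.m n))) (Option (Qubits (S.m n))) ℂ :=
  ∑ sk : Qubits (S.s n), ∑ vk : Qubits (S.v n),
    (S.keyProb n sk vk : ℂ) • (S.verChannel n vk ∘ₗ adv.channel vk ∘ₗ (S.sign n).channel sk)

/-- A family of two-outcome measurements on `H_M ⊕ ℂ|⊥⟩`, one for each security parameter. -/
abbrev Measurement (S : QSignature) : Type := ∀ n, TwoOutcome (Option (Qubits (S.m n)))

/-- `ε`-one-time `𝓛`-security: for every QPT adversary and every `L ∈ 𝓛` there is a probability `p`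
with `‖L ∘ 𝔼[Ver_vk ∘ 𝒜(vk) ∘ Sign_sk] - (p L + (1 - p) L ∘ ⊥)‖_⋄ ≤ ε`. -/
def OneTimeSecure (S : QSignature) (ε : ℕ → ℝ≥0) (𝓛 : Set S.Measurement) : Prop :=
  ∀ adv : ∀ n, QCircuit (S.c n) (S.v n) (S.c n), IsQPT adv → ∀ L ∈ 𝓛,
    ∃ p : ℕ → ℝ, ∀ n, p n ∈ Set.Icc (0 : ℝ) 1 ∧
      diamondNorm ((L n).channel ∘ₗ S.attackMap n (adv n) -
        ((p n : ℂ) • ((L n).channel ∘ₗ acceptMap (S.m n)) +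
          ((1 - p n : ℝ) : ℂ) • ((L n).channel ∘ₗ rejectMap (S.m n)))) ≤ (ε n : ℝ≥0∞)

/-- The probability that `M` has outcome `1` on the message state `ρ`. -/
noncomputable def outcomeProb (S : QSignature) (M : S.Measurement) (n : ℕ)
    (ρ : Matrix (Qubits (S.m n)) (Qubits (S.m n)) ℂ) : ℝ :=
  ((M n).P * acceptMap (S.m n) ρ).trace.re

/-- `M` is non-trivial: each of its two outcomes occurs, up to negligible error, with certainty on
some efficiently preparable message state. -/
def NonTrivial (S : QSignature) (M : S.Measurement) : Prop :=
  ∃ ρ₀ ρ₁ : ∀ n, QCircuit 0 0 (S.m n), IsQPT ρ₀ ∧ IsQPT ρ₁ ∧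
    ∃ ν : ℕ → ℝ, Negligible ν ∧ ∀ n,
      S.outcomeProb M n (ρ₀ n).outputState ≤ ν n ∧
      1 - ν n ≤ S.outcomeProb M n (ρ₁ n).outputState

end QSignature

/-! The theorem holds because a verifier that recovers a quantum message also hands it to the
attacker. Knowing `vk`, the adversary runs the unitary part of `Ver` on the signed state, swaps the
message wires with the output of a preparation circuit `R`, and runs the unitary backwards
(`attackCircuit`). The reject flag and all ancillas of the verifier stay in place.

Why this produces a signature of the state of `R`: by correctness, `Ver ∘ Sign` is close to the
identity in diamond norm. Testing this on a superposition entangled with a reference register shows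
that the joint state of the discarded wires of `Sign` and `Ver` is close to one vector `a`, in a
product with the accepted message and the same for every message (`exists_environment`,
`exists_common_environment`). So exchanging the message behind the verifier is the same, up to error
of order `ν` in squared norm, as having signed the state of `R` from the start
(`sum_nsq_sub_idealVec_le`). An event that is unlikely for `R` therefore stays unlikely after the
attack on any other message (`event_attackMap_le`).

The lower bound: let `R₀`, `R₁` prepare states on which `M` almost surely gives `0` and `1`, and let
`π` be the probability of outcome `1` on `⊥`. Signing `R₁` and attacking with `R₀` yields outcome
`0`, whereas the ideal map yields `1` with probability about `p₀ + (1 - p₀) π ≥ π`. Signing `R₀` and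
attacking with `R₁` gives a discrepancy of at least `1 - π` in the same way. In the unnormalised
norm `ε` is at least `2π` and `2(1 - π)` up to negligible error; the larger is at least `1`, and
equals `2` if `π` is `0` or `1` (`one_sub_le_of_attack`).

It remains to see that the attack is QPT: a program on stacks assembles the description of
`attackCircuit` from those of `Ver` and `R` in quadratic time (`Prog.buildAttack_within`), and
polynomial-time computations compose (`PolyTimeComputable.comp_two`). -/

/-! ### Squared norms of vectors -/

/-- The squared Euclidean norm of a finite family of complex numbers. -/
noncomputable def nsq {ι : Type*} [Fintype ι] (f : ι → ℂ) : ℝ := ∑ i, ‖f i‖ ^ 2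

section nsq
variable {ι κ : Type*} [Fintype ι] [Fintype κ]

theorem nsq_nonneg (f : ι → ℂ) : 0 ≤ nsq f := Finset.sum_nonneg fun _ _ => by positivity

theorem nsq_coe (f : ι → ℂ) : (nsq f : ℂ) = star f ⬝ᵥ f := by
  simp [nsq, dotProduct, Complex.conj_mul']

theorem nsq_smul (c : ℂ) (f : ι → ℂ) : nsq (fun i => c * f i) = ‖c‖ ^ 2 * nsq f := by
  simp [nsq, mul_pow, Finset.mul_sum]

theorem nsq_add_le (f g : ι → ℂ) : nsq (fun i => f i + g i) ≤ 2 * nsq f + 2 * nsq g := by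
  simp only [nsq, Finset.mul_sum, ← Finset.sum_add_distrib]
  refine Finset.sum_le_sum fun i _ => ?_
  have h := norm_add_le (f i) (g i)
  nlinarith [sq_nonneg (‖f i‖ - ‖g i‖), norm_nonneg (f i + g i)]

theorem nsq_mulVec_of_isometry [DecidableEq ι] {U : Matrix κ ι ℂ} (hU : Uᴴ * U = 1)
    (f : ι → ℂ) : nsq (U *ᵥ f) = nsq f := by
  have : (nsq (U *ᵥ f) : ℂ) = nsq f := by
    rw [nsq_coe, nsq_coe, Matrix.star_mulVec, Matrix.dotProduct_mulVec, Matrix.vecMul_vecMul, hU,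
      Matrix.vecMul_one]
  exact_mod_cast this

theorem norm_dotProduct_le (f g : ι → ℂ) : ‖star f ⬝ᵥ g‖ ≤ Real.sqrt (nsq f) * Real.sqrt (nsq g) := by
  refine (norm_sum_le _ _).trans ?_
  simpa [nsq] using Real.sum_mul_le_sqrt_mul_sqrt Finset.univ (fun i => ‖f i‖) (fun i => ‖g i‖)

theorem nsq_mulVec_of_isStarProjection [DecidableEq ι] {P : Matrix ι ι ℂ} (hP : IsStarProjection P)
    (f : ι → ℂ) : (nsq (P *ᵥ f) : ℂ) = star f ⬝ᵥ (P *ᵥ f) := by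
  have h1 : Pᴴ = P := hP.isSelfAdjoint
  have h2 : P * P = P := hP.isIdempotentElem
  rw [nsq_coe, Matrix.star_mulVec, ← Matrix.dotProduct_mulVec, Matrix.mulVec_mulVec, h1, h2]

theorem nsq_mulVec_le_of_isStarProjection [DecidableEq ι] {P : Matrix ι ι ℂ}
    (hP : IsStarProjection P) (f : ι → ℂ) : nsq (P *ᵥ f) ≤ nsq f := by
  have h : (nsq (P *ᵥ f) : ℂ) + nsq ((1 - P) *ᵥ f) = nsq f := by
    rw [nsq_mulVec_of_isStarProjection hP, nsq_mulVec_of_isStarProjection hP.one_sub, nsq_coe,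
      ← dotProduct_add, ← Matrix.add_mulVec]
    simp
  have h' : nsq (P *ᵥ f) + nsq ((1 - P) *ᵥ f) = nsq f := by exact_mod_cast h
  linarith [nsq_nonneg ((1 - P) *ᵥ f)]

end nsq

/-! ### The trace norm and the diamond norm -/

section traceNorm
open scoped ComplexOrder
variable {A B : Type*} [Fintype A] [DecidableEq A] [Fintype B] [DecidableEq B]

/-- Take the trace in an orthonormal eigenbasis `u` of `Yᴴ * Y`. Each diagonal term is `⟨u, Q Y u⟩`,
at most `‖Y u‖` by Cauchy–Schwarz and contractivity of `Q`, and `‖Y u‖` is the singular value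
belonging to `u`. -/
theorem norm_trace_mul_le_traceNorm {Q : Matrix A A ℂ} (hQ : ∀ v, nsq (Q *ᵥ v) ≤ nsq v)
    (Y : Matrix A A ℂ) : ‖(Q * Y).trace‖ ≤ traceNorm Y := by
  set h := Matrix.isHermitian_conjTranspose_mul_self Y
  set U : Matrix A A ℂ := (h.eigenvectorUnitary : Matrix A A ℂ)
  have hUU : U * Uᴴ = 1 := Matrix.mem_unitaryGroup_iff.1 h.eigenvectorUnitary.2
  have hUU' : Uᴴ * U = 1 := Matrix.mem_unitaryGroup_iff'.1 h.eigenvectorUnitary.2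
  have h1 : (Q * Y).trace = (Uᴴ * (Q * Y * U)).trace := by
    rw [Matrix.trace_mul_comm Uᴴ, Matrix.mul_assoc (Q * Y), hUU, Matrix.mul_one]
  rw [h1, traceNorm, Matrix.trace]
  refine (norm_sum_le _ _).trans (Finset.sum_le_sum fun i _ => ?_)
  set u : A → ℂ := fun j => U j i with hu
  have hu1 : nsq u = 1 := by
    have : (nsq u : ℂ) = (Uᴴ * U) i i := by
      rw [nsq_coe]; rfl
    rw [hUU', Matrix.one_apply_eq] at this
    exact_mod_cast this
  have hu2 : (Yᴴ * Y) *ᵥ u = (h.eigenvalues i : ℂ) • u := by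
    have := h.mulVec_eigenvectorBasis i
    have hb : u = (h.eigenvectorBasis i).ofLp := by
      ext j; simp [hu, U, Matrix.IsHermitian.eigenvectorUnitary_apply]
    rw [hb, this]; rfl
  have hu3 : nsq (Y *ᵥ u) = h.eigenvalues i := by
    have : (nsq (Y *ᵥ u) : ℂ) = h.eigenvalues i := by
      rw [nsq_coe, Matrix.star_mulVec, ← Matrix.dotProduct_mulVec, Matrix.mulVec_mulVec, hu2,
        dotProduct_smul, ← nsq_coe, hu1]
      simp
    exact_mod_cast this
  have h2 : (Uᴴ * (Q * Y * U)).diag i = star u ⬝ᵥ (Q *ᵥ (Y *ᵥ u)) := by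
    rw [Matrix.mulVec_mulVec]; rfl
  rw [h2]
  refine (norm_dotProduct_le _ _).trans ?_
  rw [hu1, Real.sqrt_one, one_mul, ← hu3]
  exact Real.sqrt_le_sqrt (hQ _)

/-- Here `Xᴴ * X = X ^ 2`. Comparing the roots of its characteristic polynomial, counted with
multiplicity, identifies its eigenvalues with the squares of those of `X`, in some order; the square
roots undo the squares because the eigenvalues of `X` are nonnegative. -/
theorem traceNorm_of_posSemidef {X : Matrix A A ℂ} (hX : X.PosSemidef) :
    traceNorm X = X.trace.re := by
  set h := Matrix.isHermitian_conjTranspose_mul_self X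
  have h0 : Xᴴ * X = cfc (fun x : ℝ => x ^ 2) X := by
    have hs : IsSelfAdjoint X := hX.1
    rw [cfc_pow_id X 2 hs, pow_two]
    congr 1
  have h1 := h.roots_charpoly_eq_eigenvalues
  have h2 := hX.1.charpoly_cfc_eq (fun x : ℝ => x ^ 2)
  rw [← h0] at h2
  rw [h2] at h1
  have h3 : Multiset.map (fun z : ℂ => Real.sqrt z.re)
      (∏ i, (Polynomial.X - Polynomial.C (((hX.1.eigenvalues i) ^ 2 : ℝ) : ℂ))).roots =
      Multiset.map (fun z : ℂ => Real.sqrt z.re)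
        (Multiset.map (fun i => (h.eigenvalues i : ℂ)) Finset.univ.val) :=
    congrArg _ h1
  rw [Polynomial.roots_prod _ _ (Finset.prod_ne_zero_iff.2 fun i _ => Polynomial.X_sub_C_ne_zero _)]
    at h3
  simp only [Polynomial.roots_X_sub_C, Multiset.bind_singleton, Multiset.map_map] at h3
  have h4 := congrArg Multiset.sum h3
  rw [traceNorm, hX.1.trace_eq_sum_eigenvalues]
  have h5 : ∑ i, Real.sqrt (hX.1.eigenvalues i ^ 2) = ∑ i, Real.sqrt (h.eigenvalues i) := by
    simpa [Function.comp_def, -Complex.ofReal_pow] using h4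
  rw [← h5]
  simp [Real.sqrt_sq (hX.eigenvalues_nonneg _)]

/-- The form in which diamond-norm bounds are exploited: a state on message and reference as input,
a contraction as test on the output. The bound is `|c|` since `ENNReal.ofReal` sends negative
numbers to `0`. -/
theorem norm_trace_mul_tensorId_le {Φ : Matrix A A ℂ →ₗ[ℂ] Matrix B B ℂ} {c : ℝ}
    (hΦ : diamondNorm Φ ≤ ENNReal.ofReal c) {d : ℕ} {X : Matrix (A × Fin d) (A × Fin d) ℂ}
    (hX : X.PosSemidef) (hX1 : X.trace = 1)
    {Q : Matrix (B × Fin d) (B × Fin d) ℂ} (hQ : ∀ v, nsq (Q *ᵥ v) ≤ nsq v) :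
    ‖(Q * tensorId (Fin d) Φ X).trace‖ ≤ |c| := by
  have h1 : traceNorm X ≤ 1 := by rw [traceNorm_of_posSemidef hX, hX1]; simp
  have h2 : ENNReal.ofReal (traceNorm (tensorId (Fin d) Φ X)) ≤ diamondNorm Φ :=
    le_iSup_of_le d (le_iSup_of_le X (le_iSup_of_le h1 le_rfl))
  have h3 := (h2.trans hΦ).trans (ENNReal.ofReal_le_ofReal (le_abs_self c))
  exact (norm_trace_mul_le_traceNorm hQ _).trans
    ((ENNReal.ofReal_le_ofReal_iff (abs_nonneg c)).1 h3)

/-- The case of a one-dimensional reference system. -/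
theorem norm_trace_mul_apply_le {Φ : Matrix A A ℂ →ₗ[ℂ] Matrix B B ℂ} {c : ℝ}
    (hΦ : diamondNorm Φ ≤ ENNReal.ofReal c) {X : Matrix A A ℂ}
    (hX : X.PosSemidef) (hX1 : X.trace = 1)
    {Q : Matrix B B ℂ} (hQ : ∀ v, nsq (Q *ᵥ v) ≤ nsq v) :
    ‖(Q * Φ X).trace‖ ≤ |c| := by
  have h := norm_trace_mul_tensorId_le hΦ (d := 1) (X := X.submatrix Prod.fst Prod.fst)
    (Q := Q.submatrix Prod.fst Prod.fst) (hX.submatrix _)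
    (by simpa [Matrix.trace, Fintype.sum_prod_type] using hX1) (fun v => by
      simpa [nsq, Fintype.sum_prod_type, Matrix.mulVec, dotProduct] using hQ fun b => v (b, 0))
  convert h using 2
  simp [Matrix.trace, Matrix.mul_apply, Fintype.sum_prod_type, tensorId]
  rfl

end traceNorm

/-! ### Unitarity of gates, inverse circuits -/

/-- The action of a controlled NOT with control `i` and target `j` on basis states. -/
def cnotFun {w : ℕ} (i j : Fin w) (y : Qubits w) : Qubits w :=
  Function.update y j (xor (y i) (y j))

theorem cnotFun_involutive {w : ℕ} {i j : Fin w} (hij : i ≠ j) :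
    Function.Involutive (cnotFun i j) := by
  intro y
  simp [cnotFun, hij]

namespace Gate
variable {w W : ℕ}

/-- The inverse gate. -/
def inv : Gate w → Gate w
  | .had i => .had i
  | .tee i => .teeDag i
  | .teeDag i => .tee i
  | .cnot i j h => .cnot i j h

/-- Evaluates products with a Hadamard matrix, whose rows have only two nonzero entries. -/
theorem sum_agree_off (i : Fin w) (x : Qubits w) (g : Qubits w → ℂ) :
    (∑ z, if ∀ j, j ≠ i → x j = z j then g z else 0) =
      g (Function.update x i true) + g (Function.update x i false) := by
  rw [← Finset.sum_filter]
  have : (Finset.univ.filter fun z : Qubits w => ∀ j, j ≠ i → x j = z j) =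
      {Function.update x i true, Function.update x i false} := by
    ext z
    simp only [Finset.mem_filter, Finset.mem_univ, true_and, Finset.mem_insert,
      Finset.mem_singleton]
    constructor
    · intro h
      rcases hz : z i with _ | _
      · right; ext j; by_cases hj : j = i
        · subst hj; simp [hz]
        · simp [hj, h j hj]
      · left; ext j; by_cases hj : j = i
        · subst hj; simp [hz]
        · simp [hj, h j hj]
    · rintro (rfl | rfl) j hj <;> simp [hj]
  rw [this, Finset.sum_pair]
  intro h
  simpa using congrFun h i

theorem inv_matrix (g : Gate w) : g.inv.matrix = g.matrixᴴ := by
  cases g with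
  | had i =>
    ext x y
    simp only [inv, matrix, Matrix.of_apply, Matrix.conjTranspose_apply]
    have : (∀ j, j ≠ i → x j = y j) ↔ ∀ j, j ≠ i → y j = x j :=
      forall₂_congr fun j _ => eq_comm
    simp only [this, and_comm]
    split_ifs <;> simp
  | tee i =>
    simp only [inv, matrix, Matrix.diagonal_conjTranspose]
    congr 1; funext x
    simp only [Pi.star_apply]
    split_ifs <;> simp [← Complex.exp_conj, Complex.conj_ofNat]
  | teeDag i =>
    simp only [inv, matrix, Matrix.diagonal_conjTranspose]
    congr 1; funext x
    simp only [Pi.star_apply]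
    split_ifs <;> simp [← Complex.exp_conj, Complex.conj_ofNat]
  | cnot i j h =>
    ext x y
    have : (x = cnotFun i j y) ↔ (y = cnotFun i j x) :=
      ⟨fun e => by rw [e, cnotFun_involutive h], fun e => by rw [e, cnotFun_involutive h]⟩
    simp only [cnotFun] at this
    simp only [inv, matrix, Matrix.of_apply, Matrix.conjTranspose_apply, this]
    split_ifs <;> simp

theorem conjTranspose_matrix_mul (g : Gate w) : g.matrixᴴ * g.matrix = 1 := by
  rw [← inv_matrix]
  cases g with
  | had i =>
    ext x y
    simp only [inv, matrix, Matrix.mul_apply, Matrix.of_apply, ite_mul, zero_mul]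
    rw [sum_agree_off]
    have h2 : (Real.sqrt 2 : ℂ) ^ 2 = 2 := by
      rw [← Complex.ofReal_pow, Real.sq_sqrt (by norm_num)]; norm_num
    have h0 : (Real.sqrt 2 : ℂ) ≠ 0 := by intro h; rw [h] at h2; norm_num at h2
    have hA : ∀ b, (∀ j, j ≠ i → Function.update x i b j = y j) ↔ ∀ j, j ≠ i → x j = y j :=
      fun b => forall₂_congr fun j hj => by simp [hj]
    simp only [hA, Function.update_self]
    by_cases hxy : ∀ j, j ≠ i → x j = y j
    · simp only [if_pos hxy, Matrix.one_apply]
      have hE : x = y ↔ x i = y i := ⟨fun h => by rw [h], fun h => by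
        ext j; by_cases hj : j = i
        · rw [hj, h]
        · rw [hxy j hj]⟩
      simp only [hE]
      rcases x i with _ | _ <;> rcases y i with _ | _ <;> simp <;> field_simp <;> rw [h2] <;> norm_num
    · have : x ≠ y := fun h => hxy fun j _ => by rw [h]
      simp only [hxy, if_false, mul_zero, add_zero, Matrix.one_apply, this]
  | tee i =>
    simp only [inv, matrix, Matrix.diagonal_mul_diagonal, ← Matrix.diagonal_one]
    congr 1; funext x
    split_ifs <;> simp [← Complex.exp_add]
  | teeDag i =>
    simp only [inv, matrix, Matrix.diagonal_mul_diagonal, ← Matrix.diagonal_one]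
    congr 1; funext x
    split_ifs <;> simp [← Complex.exp_add]
  | cnot i j h =>
    ext x y
    simp only [inv, matrix, Matrix.mul_apply, Matrix.of_apply, mul_ite, mul_one, mul_zero,
      Finset.sum_ite_eq', Finset.mem_univ, if_true]
    have : (x = cnotFun i j (cnotFun i j y)) ↔ x = y := by rw [cnotFun_involutive h]
    simp only [cnotFun] at this
    simp only [this, Matrix.one_apply]

/-- The same gate on relabelled wires. -/
def map (f : Fin w → Fin W) (hf : Function.Injective f) : Gate w → Gate W
  | .had i => .had (f i)
  | .tee i => .tee (f i)
  | .teeDag i => .teeDag (f i)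
  | .cnot i j h => .cnot (f i) (f j) (hf.ne h)

theorem eq_iff_off_range (f : Fin w → Fin W) (x y : Qubits W) :
    x = y ↔ (∀ k, k ∉ Set.range f → x k = y k) ∧ x ∘ f = y ∘ f := by
  refine ⟨fun h => h ▸ ⟨fun _ _ => rfl, rfl⟩, fun ⟨h1, h2⟩ => funext fun k => ?_⟩
  by_cases hk : k ∈ Set.range f
  · obtain ⟨i, rfl⟩ := hk
    exact congrFun h2 i
  · exact h1 k hk

-- A relabelled gate is the original one tensored with the identity on the wires outside the range
-- of `f`.
open Classical in
theorem map_matrix (f : Fin w → Fin W) (hf : Function.Injective f) (g : Gate w) (x y : Qubits W) :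
    (g.map f hf).matrix x y =
      if ∀ k, k ∉ Set.range f → x k = y k then g.matrix (x ∘ f) (y ∘ f) else 0 := by
  cases g with
  | had i =>
    have : (∀ j, j ≠ f i → x j = y j) ↔ (∀ k, k ∉ Set.range f → x k = y k) ∧
        ∀ j, j ≠ i → (x ∘ f) j = (y ∘ f) j := by
      constructor
      · exact fun h => ⟨fun k hk => h k fun e => hk ⟨i, e.symm⟩, fun j hj => h _ (hf.ne hj)⟩
      · rintro ⟨h1, h2⟩ j hj
        by_cases hk : j ∈ Set.range f
        · obtain ⟨k, rfl⟩ := hk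
          exact h2 k fun e => hj (by rw [e])
        · exact h1 j hk
    simp only [map, matrix, Matrix.of_apply, this, ite_and, Function.comp_apply]
  | tee i =>
    simp only [map, matrix, Matrix.diagonal_apply, eq_iff_off_range f x y, ite_and,
      Function.comp_apply]
  | teeDag i =>
    simp only [map, matrix, Matrix.diagonal_apply, eq_iff_off_range f x y, ite_and,
      Function.comp_apply]
  | cnot i j h =>
    have : (x = Function.update y (f j) (xor (y (f i)) (y (f j)))) ↔
        (∀ k, k ∉ Set.range f → x k = y k) ∧
        x ∘ f = Function.update (y ∘ f) j (xor ((y ∘ f) i) ((y ∘ f) j)) := by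
      rw [eq_iff_off_range f]
      refine and_congr (forall₂_congr fun k hk => ?_) ?_
      · rw [Function.update_of_ne]; rintro rfl; exact hk ⟨j, rfl⟩
      · rw [Function.update_comp_eq_of_injective y hf]; rfl
    simp only [map, matrix, Matrix.of_apply, this, ite_and]

theorem map_castAdd_matrix {w' : ℕ} (g : Gate w) (x y : Qubits w) (x' y' : Qubits w') :
    (g.map (Fin.castAdd w') (Fin.castAdd_injective w w')).matrix (Fin.append x x')
      (Fin.append y y') = if x' = y' then g.matrix x y else 0 := by
  rw [map_matrix]
  have h1 : (∀ k, k ∉ Set.range (Fin.castAdd w' : Fin w → _) →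
      Fin.append x x' k = Fin.append y y' k) ↔ x' = y' := by
    constructor
    · intro h; ext k
      simpa using h (Fin.natAdd w k) (by rintro ⟨i, hi⟩; simp [Fin.ext_iff] at hi; omega)
    · rintro rfl k hk
      induction k using Fin.addCases with
      | left i => exact absurd ⟨i, rfl⟩ hk
      | right i => simp
  have h2 : ∀ z : Qubits w, ∀ z' : Qubits w', Fin.append z z' ∘ Fin.castAdd w' = z := by
    intro z z'; ext i; simp
  simp only [h1, h2]

theorem map_natAdd_matrix {w' : ℕ} (g : Gate w') (x y : Qubits w) (x' y' : Qubits w') :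
    (g.map (Fin.natAdd w) (Fin.natAdd_injective w' w)).matrix (Fin.append x x')
      (Fin.append y y') = if x = y then g.matrix x' y' else 0 := by
  rw [map_matrix]
  have h1 : (∀ k, k ∉ Set.range (Fin.natAdd w : Fin w' → _) →
      Fin.append x x' k = Fin.append y y' k) ↔ x = y := by
    constructor
    · intro h; ext k
      simpa using h (Fin.castAdd w' k) (by rintro ⟨i, hi⟩; simp [Fin.ext_iff] at hi; omega)
    · rintro rfl k hk
      induction k using Fin.addCases with
      | left i => simp
      | right i => exact absurd ⟨i, rfl⟩ hk
  have h2 : ∀ z : Qubits w, ∀ z' : Qubits w', Fin.append z z' ∘ Fin.natAdd w = z' := by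
    intro z z'; ext i; simp
  simp only [h1, h2]

end Gate

/-! ### Matrices of gate lists acting on part of the wires -/

section gatesMatrix
variable {w w' : ℕ}

theorem gatesMatrix_append (l₁ l₂ : List (Gate w)) :
    gatesMatrix (l₁ ++ l₂) = gatesMatrix l₂ * gatesMatrix l₁ := by
  induction l₁ with
  | nil => simp [gatesMatrix]
  | cons g l ih => simp [gatesMatrix, ih, Matrix.mul_assoc]

theorem conjTranspose_gatesMatrix_mul (l : List (Gate w)) :
    (gatesMatrix l)ᴴ * gatesMatrix l = 1 := by
  induction l with
  | nil => simp [gatesMatrix]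
  | cons g l ih =>
    rw [gatesMatrix, Matrix.conjTranspose_mul, Matrix.mul_assoc, ← Matrix.mul_assoc _ _ g.matrix,
      ih, Matrix.one_mul, g.conjTranspose_matrix_mul]

/-- The gates of the inverse circuit. -/
def invGates (l : List (Gate w)) : List (Gate w) := (l.map Gate.inv).reverse

theorem gatesMatrix_invGates (l : List (Gate w)) : gatesMatrix (invGates l) = (gatesMatrix l)ᴴ := by
  induction l with
  | nil => simp [gatesMatrix, invGates]
  | cons g l ih =>
    have : invGates (g :: l) = invGates l ++ [g.inv] := by simp [invGates]
    rw [this, gatesMatrix_append, ih]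
    simp [gatesMatrix, Gate.inv_matrix]

theorem sum_append (F : Qubits (w + w') → ℂ) :
    ∑ z, F z = ∑ x : Qubits w, ∑ x' : Qubits w', F (Fin.append x x') := by
  rw [← Fintype.sum_prod_type', ← (Fin.appendEquiv (α := Bool) w w').sum_comp]
  rfl

/-- A list of gates acting on the first `w` wires. -/
def leftGates (w' : ℕ) (l : List (Gate w)) : List (Gate (w + w')) :=
  l.map (Gate.map (Fin.castAdd w') (Fin.castAdd_injective w w'))

/-- A list of gates acting on the last `w'` wires. -/
def rightGates (w : ℕ) (l : List (Gate w')) : List (Gate (w + w')) :=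
  l.map (Gate.map (Fin.natAdd w) (Fin.natAdd_injective w' w))

theorem append_inj_iff (x y : Qubits w) (x' y' : Qubits w') :
    Fin.append x x' = Fin.append y y' ↔ x = y ∧ x' = y' := by
  rw [← Prod.mk_inj]
  exact (Fin.appendEquiv (α := Bool) w w').injective.eq_iff (a := (x, x')) (b := (y, y'))

theorem gatesMatrix_leftGates (l : List (Gate w)) (x y : Qubits w) (x' y' : Qubits w') :
    gatesMatrix (leftGates w' l) (Fin.append x x') (Fin.append y y') =
      if x' = y' then gatesMatrix l x y else 0 := by
  induction l generalizing y y' with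
  | nil =>
    simp only [leftGates, List.map_nil, gatesMatrix, Matrix.one_apply, append_inj_iff,
      and_comm (a := x = y), ite_and]
  | cons g l ih =>
    rw [leftGates] at ih
    rw [leftGates, List.map_cons, gatesMatrix, gatesMatrix, Matrix.mul_apply, sum_append]
    simp only [ih, Gate.map_castAdd_matrix]
    by_cases h : x' = y' <;> simp [Matrix.mul_apply, h]

theorem gatesMatrix_rightGates (l : List (Gate w')) (x y : Qubits w) (x' y' : Qubits w') :
    gatesMatrix (rightGates w l) (Fin.append x x') (Fin.append y y') =
      if x = y then gatesMatrix l x' y' else 0 := by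
  induction l generalizing y y' with
  | nil =>
    simp only [rightGates, List.map_nil, gatesMatrix, Matrix.one_apply, append_inj_iff, ite_and]
  | cons g l ih =>
    rw [rightGates] at ih
    rw [rightGates, List.map_cons, gatesMatrix, gatesMatrix, Matrix.mul_apply, sum_append]
    rw [Finset.sum_comm]
    simp only [ih, Gate.map_natAdd_matrix]
    by_cases h : x = y <;> simp [Matrix.mul_apply, h]

/-! ### Swapping wires -/

/-- Three controlled NOTs that swap the wires `i` and `j`. -/
def swapGates (i j : Fin w) (h : i ≠ j) : List (Gate w) :=
  [.cnot i j h, .cnot j i h.symm, .cnot i j h]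

theorem cnotFun_swap {i j : Fin w} (h : i ≠ j) (y : Qubits w) :
    cnotFun i j (cnotFun j i (cnotFun i j y)) = y ∘ Equiv.swap i j := by
  ext k
  simp only [cnotFun, Function.comp_apply]
  by_cases hi : k = i
  · subst hi
    simp only [h, ne_eq, not_false_eq_true, Function.update_of_ne, Function.update_self,
      Equiv.swap_apply_left]
    rcases y j with _ | _ <;> rcases y k with _ | _ <;> rfl
  · by_cases hj : k = j
    · subst hj
      simp only [Function.update_self, ne_eq, hi, not_false_eq_true, Function.update_of_ne, h,
        Equiv.swap_apply_right]
      rcases y i with _ | _ <;> rcases y k with _ | _ <;> rfl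
    · simp [hi, hj, Equiv.swap_apply_of_ne_of_ne]

theorem gatesMatrix_swapGates {i j : Fin w} (h : i ≠ j) (x y : Qubits w) :
    gatesMatrix (swapGates i j h) x y = if x = y ∘ Equiv.swap i j then 1 else 0 := by
  have hm : ∀ (i j : Fin w) (h : i ≠ j), (Gate.cnot i j h).matrix =
      Matrix.of fun x y => if x = cnotFun i j y then 1 else 0 := fun _ _ _ => rfl
  simp only [swapGates, gatesMatrix, hm, Matrix.one_mul, Matrix.mul_apply, Matrix.of_apply,
    mul_ite, mul_one, mul_zero, Finset.sum_ite_eq', Finset.mem_univ, if_true,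
    cnotFun_swap h]

/-- Swap the wire `α i` with the wire `β i`, for all `i`. -/
def swapAll : ∀ {m : ℕ} (α β : Fin m → Fin w) (_ : ∀ i, α i ≠ β i), List (Gate w)
  | 0, _, _, _ => []
  | m + 1, α, β, h => swapGates (α (Fin.last m)) (β (Fin.last m)) (h _) ++
      swapAll (fun i => α i.castSucc) (fun i => β i.castSucc) fun _ => h _

/-- The swaps act on basis states by a permutation of wires. Disjointness of the two ranges makes
the transpositions independent of each other, so each added one leaves the values found by induction
unchanged. -/
theorem gatesMatrix_swapAll {m : ℕ} (α β : Fin m → Fin w) (hα : Function.Injective α)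
    (hβ : Function.Injective β) (h : ∀ i j, α i ≠ β j) :
    ∃ σ : Equiv.Perm (Fin w),
      (∀ x y, gatesMatrix (swapAll α β fun i => h i i) x y = if x = y ∘ σ then 1 else 0) ∧
      (∀ i, σ (α i) = β i) ∧ (∀ i, σ (β i) = α i) ∧
      ∀ k, k ∉ Set.range α → k ∉ Set.range β → σ k = k := by
  induction m with
  | zero =>
    exact ⟨1, by simp [swapAll, gatesMatrix, Matrix.one_apply], fun i => i.elim0, fun i => i.elim0,
      fun _ _ _ => rfl⟩
  | succ m ih =>
    obtain ⟨σ, h1, h2, h3, h4⟩ := ih (fun i => α i.castSucc) (fun i => β i.castSucc)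
      (hα.comp (Fin.castSucc_injective m)) (hβ.comp (Fin.castSucc_injective m)) fun i j => h _ _
    have hne : ∀ i : Fin m, i.castSucc ≠ Fin.last m := fun i => (Fin.castSucc_lt_last i).ne
    refine ⟨Equiv.swap (α (Fin.last m)) (β (Fin.last m)) * σ, fun x y => ?_, fun i => ?_,
      fun i => ?_, fun k hk1 hk2 => ?_⟩
    · simp only [swapAll, gatesMatrix_append, Matrix.mul_apply, h1, gatesMatrix_swapGates, mul_ite,
        mul_one, mul_zero, Finset.sum_ite_eq', Finset.mem_univ, if_true]
      rfl
    · rw [Equiv.Perm.mul_apply]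
      induction i using Fin.lastCases with
      | last =>
        rw [h4 _ (by rintro ⟨i, hi⟩; exact hne i (hα hi)) (by rintro ⟨i, hi⟩; exact h _ _ hi.symm),
          Equiv.swap_apply_left]
      | cast i =>
        rw [h2, Equiv.swap_apply_of_ne_of_ne (h _ _).symm (hβ.ne (hne i))]
    · rw [Equiv.Perm.mul_apply]
      induction i using Fin.lastCases with
      | last =>
        rw [h4 _ (by rintro ⟨i, hi⟩; exact h _ _ hi) (by rintro ⟨i, hi⟩; exact hne i (hβ hi)),
          Equiv.swap_apply_right]
      | cast i =>
        rw [h3, Equiv.swap_apply_of_ne_of_ne (hα.ne (hne i)) (h _ _)]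
    · rw [Equiv.Perm.mul_apply, h4 k (fun ⟨i, hi⟩ => hk1 ⟨_, hi⟩) (fun ⟨i, hi⟩ => hk2 ⟨_, hi⟩),
        Equiv.swap_apply_of_ne_of_ne (fun e => hk1 ⟨_, e.symm⟩) (fun e => hk2 ⟨_, e.symm⟩)]

end gatesMatrix

/-! ### Kraus decompositions -/

/-- The matrices `K i` are Kraus operators of the trace-preserving map `Φ`. -/
structure HasKraus {A B ι : Type*} [Fintype A] [DecidableEq A] [Fintype B] [Fintype ι]
    (Φ : Matrix A A ℂ →ₗ[ℂ] Matrix B B ℂ) (K : ι → Matrix B A ℂ) : Prop where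
  apply : ∀ X, Φ X = ∑ i, K i * X * (K i)ᴴ
  isometric : ∑ i, (K i)ᴴ * K i = 1

/-- The rank-one matrix `|u⟩⟨u|`. -/
def ketBra {A : Type*} (u : A → ℂ) : Matrix A A ℂ := Matrix.vecMulVec u (star u)

section ketBra
variable {A : Type*} [Fintype A]

open scoped ComplexOrder in
theorem posSemidef_ketBra (u : A → ℂ) : (ketBra u).PosSemidef :=
  Matrix.posSemidef_vecMulVec_self_star u

theorem trace_ketBra (u : A → ℂ) : (ketBra u).trace = nsq u := by
  rw [ketBra, Matrix.trace_vecMulVec, dotProduct_comm, nsq_coe]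

theorem mul_ketBra_mul {B : Type*} (K : Matrix B A ℂ) (u : A → ℂ) :
    K * ketBra u * Kᴴ = ketBra (K *ᵥ u) := by
  rw [ketBra, ketBra, Matrix.mul_vecMulVec, Matrix.vecMulVec_mul, Matrix.star_mulVec]

theorem trace_mul_ketBra (Q : Matrix A A ℂ) (u : A → ℂ) :
    (Q * ketBra u).trace = star u ⬝ᵥ (Q *ᵥ u) := by
  rw [ketBra, Matrix.mul_vecMulVec, Matrix.trace_vecMulVec, dotProduct_comm]

end ketBra

namespace HasKraus
variable {A B ι : Type*} [Fintype A] [DecidableEq A] [Fintype B] [Fintype ι]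
  {Φ : Matrix A A ℂ →ₗ[ℂ] Matrix B B ℂ} {K : ι → Matrix B A ℂ}

theorem trace_eq (h : HasKraus Φ K) (X : Matrix A A ℂ) : (Φ X).trace = X.trace := by
  have : ∀ i, (K i * X * (K i)ᴴ).trace = ((K i)ᴴ * K i * X).trace := fun i => by
    rw [Matrix.trace_mul_comm, Matrix.mul_assoc]
  rw [h.apply, Matrix.trace_sum, Finset.sum_congr rfl fun i _ => this i, ← Matrix.trace_sum,
    ← Finset.sum_mul, h.isometric, one_mul]

theorem apply_ketBra (h : HasKraus Φ K) (u : A → ℂ) :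
    Φ (ketBra u) = ∑ i, ketBra (K i *ᵥ u) := by
  simp only [h.apply, mul_ketBra_mul]

theorem sum_nsq (h : HasKraus Φ K) (u : A → ℂ) : ∑ i, nsq (K i *ᵥ u) = nsq u := by
  have h1 := h.trace_eq (ketBra u)
  simp only [h.apply_ketBra, Matrix.trace_sum, trace_ketBra] at h1
  exact_mod_cast h1

theorem comp {C κ : Type*} [DecidableEq B] [Fintype C] [Fintype κ]
    {Ψ : Matrix B B ℂ →ₗ[ℂ] Matrix C C ℂ} {L : κ → Matrix C B ℂ}
    (hΦ : HasKraus Φ K) (hΨ : HasKraus Ψ L) :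
    HasKraus (Ψ ∘ₗ Φ) fun p : ι × κ => L p.2 * K p.1 where
  apply X := by
    simp only [LinearMap.comp_apply, hΦ.apply, hΨ.apply, Fintype.sum_prod_type,
      Matrix.conjTranspose_mul, Matrix.mul_sum, Matrix.sum_mul, Matrix.mul_assoc]
    rw [Finset.sum_comm]
  isometric := by
    have : ∀ i, ∑ j, (L j * K i)ᴴ * (L j * K i) = (K i)ᴴ * K i := fun i => by
      have h1 : ∀ j, (L j * K i)ᴴ * (L j * K i) = (K i)ᴴ * ((L j)ᴴ * L j) * K i := fun j => by
        simp only [Matrix.conjTranspose_mul, Matrix.mul_assoc]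
      simp only [h1, ← Matrix.mul_sum, ← Matrix.sum_mul, hΨ.isometric, Matrix.mul_one]
    rw [Fintype.sum_prod_type]
    simp only [this, hΦ.isometric]

end HasKraus

/-! ### Kraus operators of circuits -/

theorem joinWires_inj {b w : ℕ} (h : b ≤ w) {y y' : Qubits b} {e e' : Qubits (w - b)}
    (hj : joinWires y e = joinWires y' e') : y = y' ∧ e = e' := by
  constructor
  · ext i
    simpa [joinWires] using congrFun hj ⟨i, by omega⟩
  · ext i
    simpa [joinWires] using congrFun hj ⟨b + i, by omega⟩

/-- Basis states of `w` qubits as pairs of a state of the first `b` and one of the others. -/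
def joinEquiv {b w : ℕ} (h : b ≤ w) : Qubits b × Qubits (w - b) ≃ Qubits w where
  toFun p := joinWires p.1 p.2
  invFun x := (fun i => x ⟨i, by omega⟩, fun i => x ⟨b + i, by omega⟩)
  left_inv p := by
    ext i <;> simp [joinWires]
  right_inv x := by
    ext i
    simp only [joinWires]
    split_ifs with hi
    · rfl
    · congr 1; ext; simp; omega

theorem sum_joinWires {M : Type*} [AddCommMonoid M] {b w : ℕ} (h : b ≤ w) (F : Qubits w → M) :
    ∑ x, F x = ∑ y : Qubits b, ∑ e : Qubits (w - b), F (joinWires y e) := by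
  rw [← Fintype.sum_prod_type', ← (joinEquiv h).sum_comp]
  rfl

theorem initialState_injective {a k w : ℕ} (h : a ≤ w) (key : Qubits k) :
    Function.Injective (initialState (a := a) w key) := by
  intro y y' hy
  ext i
  simpa [initialState] using congrFun hy ⟨i, by omega⟩

namespace QCircuit
variable {a k b : ℕ} (C : QCircuit a k b) (key : Qubits k)

/-- The Kraus operators of a circuit, indexed by the state of the discarded wires. -/
noncomputable def kraus (e : Qubits (C.wires - b)) : Matrix (Qubits b) (Qubits a) ℂ :=
  Matrix.of fun y x => C.isometry key (joinWires y e) x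

theorem conjTranspose_isometry_mul : (C.isometry key)ᴴ * C.isometry key = 1 := by
  have hw : a ≤ C.wires := by have := C.input_le; omega
  ext y y'
  have := congrFun₂ (conjTranspose_gatesMatrix_mul C.gates) (initialState C.wires key y)
    (initialState C.wires key y')
  simpa [Matrix.mul_apply, isometry, Matrix.one_apply, (initialState_injective hw key).eq_iff]
    using this

theorem hasKraus : HasKraus (C.channel key) (C.kraus key) where
  apply X := by
    ext y y'
    simp [channel, keepFirst, conjBy, kraus, Matrix.mul_apply, Matrix.sum_apply]
  isometric := by
    rw [← C.conjTranspose_isometry_mul key]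
    ext y y'
    simp only [Matrix.sum_apply, Matrix.mul_apply, Matrix.conjTranspose_apply, kraus,
      Matrix.of_apply]
    rw [sum_joinWires C.output_le, Finset.sum_comm]

end QCircuit

/-- The state of all wires at the end of a circuit without input. -/
noncomputable def QCircuit.finalVec {b : ℕ} (C : QCircuit 0 0 b) : Qubits C.wires → ℂ := fun x =>
  gatesMatrix C.gates x fun _ => false

theorem QCircuit.isometry_eq_finalVec {b : ℕ} (C : QCircuit 0 0 b) (x : Qubits C.wires)
    (y : Qubits 0) : C.isometry Fin.elim0 x y = C.finalVec x := by
  simp only [isometry, finalVec, Matrix.of_apply]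
  congr 1

/-- The (unnormalised) pure states whose mixture is the output of a circuit without input. -/
noncomputable def QCircuit.component {b : ℕ} (C : QCircuit 0 0 b) (e : Qubits (C.wires - b)) :
    Qubits b → ℂ := fun y => C.finalVec (joinWires y e)

theorem QCircuit.outputState_eq {b : ℕ} (C : QCircuit 0 0 b) :
    C.outputState = ∑ e, ketBra (C.component e) := by
  rw [outputState, (C.hasKraus Fin.elim0).apply]
  refine Finset.sum_congr rfl fun e _ => ?_
  ext y y'
  simp [Matrix.mul_apply, kraus, isometry_eq_finalVec, ketBra, component, Matrix.vecMulVec]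

theorem QCircuit.trace_outputState {b : ℕ} (C : QCircuit 0 0 b) : C.outputState.trace = 1 := by
  rw [outputState, (C.hasKraus Fin.elim0).trace_eq]
  simp

theorem QCircuit.sum_nsq_component {b : ℕ} (C : QCircuit 0 0 b) :
    ∑ e, nsq (C.component e) = 1 := by
  have h := C.trace_outputState
  simp only [C.outputState_eq, Matrix.trace_sum, trace_ketBra] at h
  exact_mod_cast h

open scoped ComplexOrder in
theorem QCircuit.posSemidef_outputState {b : ℕ} (C : QCircuit 0 0 b) :
    C.outputState.PosSemidef := by
  rw [C.outputState_eq]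
  exact Matrix.posSemidef_sum _ fun e _ => posSemidef_ketBra _

/-! ### Kraus operators of `readFlag` -/

/-- The Kraus operators of `readFlag`. -/
noncomputable def flagKraus (m : ℕ) (z : Qubits m) :
    Matrix (Option (Qubits m)) (Qubits (m + 1)) ℂ :=
  Matrix.of fun u (x : Qubits (m + 1)) =>
    match u with
    | some y => if x = Fin.cons false y ∧ z = (fun _ => false) then 1 else 0
    | none => if x = Fin.cons true z then 1 else 0

theorem sum_cons {M : Type*} [AddCommMonoid M] {m : ℕ} (F : Qubits (m + 1) → M) :
    ∑ x, F x = ∑ y : Qubits m, F (Fin.cons true y) + ∑ y : Qubits m, F (Fin.cons false y) := by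
  rw [← (Fin.consEquiv fun _ : Fin (m + 1) => Bool).sum_comp, Fintype.sum_prod_type]
  simp [Fin.consEquiv]

theorem hasKraus_readFlag (m : ℕ) : HasKraus (readFlag m) (flagKraus m) where
  apply X := by
    simp only [readFlag, LinearMap.sum_apply]
    rfl
  isometric := by
    ext x x'
    have hc : ∀ x : Qubits (m + 1), ∀ b y, x = Fin.cons b y ↔ x 0 = b ∧ Fin.tail x = y := by
      intro x b y
      rw [← Fin.cons_self_tail x, Fin.cons_inj]
      simp
    have he : x = x' ↔ x 0 = x' 0 ∧ Fin.tail x = Fin.tail x' := by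
      rw [← hc x, Fin.cons_self_tail]
    simp only [Matrix.sum_apply, Matrix.mul_apply, Matrix.conjTranspose_apply, flagKraus,
      Matrix.of_apply, Fintype.sum_option, hc, Matrix.one_apply, he]
    rcases x 0 with _ | _ <;> rcases x' 0 with _ | _ <;>
      simp [eq_comm, ite_and]

/-- Only the Kraus operator with `z` all zero has accepting rows, so no sum over `z` is left. -/
theorem readFlag_some_some (m : ℕ) (X : Matrix (Qubits (m + 1)) (Qubits (m + 1)) ℂ)
    (y y' : Qubits m) :
    readFlag m X (some y) (some y') = X (Fin.cons false y) (Fin.cons false y') := by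
  rw [(hasKraus_readFlag m).apply]
  simp [Matrix.sum_apply, Matrix.mul_apply, flagKraus, ite_and]

/-! ### Information and disturbance -/

/-- Pythagoras for the projection of `g` onto the line spanned by the unit vector `ξ`. -/
theorem nsq_sub_smul {ι : Type*} [Fintype ι] {ξ : ι → ℂ} (hξ : nsq ξ = 1) (g : ι → ℂ) :
    nsq (fun i => g i - (star ξ ⬝ᵥ g) * ξ i) = nsq g - ‖star ξ ⬝ᵥ g‖ ^ 2 := by
  have h : ∀ i, ‖g i - (star ξ ⬝ᵥ g) * ξ i‖ ^ 2 = ‖g i‖ ^ 2 + ‖star ξ ⬝ᵥ g‖ ^ 2 * ‖ξ i‖ ^ 2 -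
      2 * (star (star ξ ⬝ᵥ g) * (star (ξ i) * g i)).re := by
    intro i
    simp only [Complex.sq_norm, Complex.normSq_sub, map_mul, Complex.star_def]
    congr 3
    ring
  have h2 : ∑ i, (star (star ξ ⬝ᵥ g) * (star (ξ i) * g i)).re = ‖star ξ ⬝ᵥ g‖ ^ 2 := by
    rw [← Complex.re_sum, ← Finset.mul_sum]
    change (star (star ξ ⬝ᵥ g) * (star ξ ⬝ᵥ g)).re = _
    rw [Complex.star_def, Complex.conj_mul']
    norm_cast
  simp only [nsq] at hξ ⊢
  simp only [h, Finset.sum_sub_distrib, Finset.sum_add_distrib, ← Finset.mul_sum, h2, hξ]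
  ring

/-- The vector with amplitudes `ξ y * a f` at `|0⟩ ⊗ |y⟩ ⊗ |f⟩` and `0` at `|1⟩ ⊗ |y⟩ ⊗ |f⟩`. -/
def acceptVec {Y F : Type*} (ξ : Y → ℂ) (a : F → ℂ) (b : Bool) (y : Y) (f : F) : ℂ :=
  if b then 0 else ξ y * a f

theorem sum_flag {m w : ℕ} (h : m + 1 ≤ w) (F : Qubits w → ℝ) :
    ∑ x, F x = ∑ b, ∑ y : Qubits m, ∑ f : Qubits (w - (m + 1)),
      F (joinWires (Fin.cons b y : Qubits (m + 1)) f) := by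
  rw [sum_joinWires h, sum_cons]
  simp

section disturbance
variable {Y F E T : Type*} [Fintype Y] [Fintype F] [Fintype E] [Fintype T]

/-- Brings the environment indices `e`, `f` to the outside, so that Pythagoras can be applied for
each of their values separately, in the joint space of `t` and `y`. -/
theorem sum_comm_environment (G : T → E → Bool → Y → F → ℝ) :
    ∑ t, ∑ e, ∑ b, ∑ y, ∑ f, G t e b y f = ∑ e, ∑ f, ∑ b, ∑ t, ∑ y, G t e b y f := by
  simp only [← Fintype.sum_prod_type']
  exact Fintype.sum_equiv ⟨fun (t, e, b, y, f) => (e, f, b, t, y),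
    fun (e, f, b, t, y) => (t, e, b, y, f), fun _ => rfl, fun _ => rfl⟩ _ _ fun _ => rfl

/-- If a family of vectors `g t e : |b⟩ ⊗ |y⟩ ⊗ |f⟩` has large overlap with `ξ t` in the register
`y`, then it is close to a product state with the same state of the environment for all `t`. -/
theorem sum_nsq_sub_acceptVec_le {ξ : T → Y → ℂ} (hξ : ∑ t, nsq (ξ t) = 1)
    (g : T → E → Bool → Y → F → ℂ) (hg : ∑ t, ∑ e, ∑ b, ∑ y, ∑ f, ‖g t e b y f‖ ^ 2 = 1) {δ : ℝ}
    (h : 1 - ∑ e, ∑ f, ‖∑ t, ∑ y, star (ξ t y) * g t e false y f‖ ^ 2 ≤ δ) :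
    ∃ a : E → F → ℂ,
      ∑ t, ∑ e, ∑ b, ∑ y, ∑ f, ‖g t e b y f - acceptVec (ξ t) (a e) b y f‖ ^ 2 ≤ δ := by
  -- The environment amplitude is the overlap of `g` with `ξ`, the coefficient of the orthogonal
  -- projection. The squared distance is then the total weight `1` minus the weight of the overlaps;
  -- the rejecting part `b = true` counts fully as error.
  refine ⟨fun e f => ∑ t, ∑ y, star (ξ t y) * g t e false y f, le_trans (le_of_eq ?_) h⟩
  have hξ' : nsq (fun p : T × Y => ξ p.1 p.2) = 1 := by
    simpa only [nsq, Fintype.sum_prod_type] using hξ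
  have key := fun e f => nsq_sub_smul hξ' (fun p : T × Y => g p.1 e false p.2 f)
  simp only [nsq, dotProduct, Fintype.sum_prod_type, Pi.star_apply] at key
  have h1 : ∀ e f, ∑ b, ∑ t, ∑ y, ‖g t e b y f - acceptVec (ξ t)
      (fun f => ∑ t, ∑ y, star (ξ t y) * g t e false y f) b y f‖ ^ 2 =
      ∑ b, ∑ t, ∑ y, ‖g t e b y f‖ ^ 2 - ‖∑ t, ∑ y, star (ξ t y) * g t e false y f‖ ^ 2 := by
    intro e f
    simp only [Fintype.sum_bool, acceptVec, if_true, sub_zero, Bool.false_eq_true, if_false]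
    rw [add_sub_assoc, ← key]
    simp only [mul_comm (∑ t, ∑ y, star (ξ t y) * g t e false y f)]
  rw [← hg, sum_comm_environment, sum_comm_environment fun t e b y f => ‖g t e b y f‖ ^ 2]
  simp only [h1, Finset.sum_sub_distrib]

end disturbance

/-! ### Swapping two registers -/

theorem norm_sub_sq_le (z z' : ℂ) : ‖z - z'‖ ^ 2 ≤ 2 * ‖z‖ ^ 2 + 2 * ‖z'‖ ^ 2 := by
  have h := norm_sub_le z z'
  nlinarith [sq_nonneg (‖z‖ - ‖z'‖), norm_nonneg (z - z')]

section swap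
variable {R S E Y F : Type*} [Fintype R] [Fintype S] [Fintype E] [Fintype Y] [Fintype F]

theorem sum_mul_left_register (u : R → E → Bool → Y → F → ℝ) (v : S → Y → ℝ) :
    ∑ r, ∑ e, ∑ b, ∑ y, ∑ f, ∑ y', ∑ s, u r e b y' f * v s y =
      (∑ r, ∑ e, ∑ b, ∑ y, ∑ f, u r e b y f) * ∑ s, ∑ y, v s y := by
  simp only [← Fintype.sum_prod_type']
  rw [Finset.sum_mul_sum, ← Fintype.sum_prod_type']
  exact Fintype.sum_equiv ⟨fun (r, e, b, y, f, y', s) => ((r, e, b, y', f), (s, y)),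
    fun ((r, e, b, y', f), (s, y)) => (r, e, b, y, f, y', s), fun _ => rfl, fun _ => rfl⟩ _ _
    fun _ => rfl

theorem sum_mul_right_register (u : S → E → Bool → Y → F → ℝ) (v : R → Y → ℝ) :
    ∑ r, ∑ e, ∑ b, ∑ y, ∑ f, ∑ y', ∑ s, u s e b y f * v r y' =
      (∑ s, ∑ e, ∑ b, ∑ y, ∑ f, u s e b y f) * ∑ r, ∑ y, v r y := by
  simp only [← Fintype.sum_prod_type']
  rw [Finset.sum_mul_sum, ← Fintype.sum_prod_type']
  exact Fintype.sum_equiv ⟨fun (r, e, b, y, f, y', s) => ((s, e, b, y, f), (r, y')),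
    fun ((s, e, b, y, f), (r, y')) => (r, e, b, y, f, y', s), fun _ => rfl, fun _ => rfl⟩ _ _
    fun _ => rfl

theorem sum_two_mul_add_two_mul (G G' : R → E → Bool → Y → F → Y → S → ℝ) :
    ∑ r, ∑ e, ∑ b, ∑ y, ∑ f, ∑ y', ∑ s, (2 * G r e b y f y' s + 2 * G' r e b y f y' s) =
      2 * ∑ r, ∑ e, ∑ b, ∑ y, ∑ f, ∑ y', ∑ s, G r e b y f y' s +
      2 * ∑ r, ∑ e, ∑ b, ∑ y, ∑ f, ∑ y', ∑ s, G' r e b y f y' s := by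
  simp only [Finset.mul_sum, Finset.sum_add_distrib]

/-- Both products are compared with the common value `c * c' * a`. -/
theorem norm_mul_sub_mul_sq_le (A B c c' a : ℂ) :
    ‖A * c - B * c'‖ ^ 2 ≤
      2 * (‖A - c' * a‖ ^ 2 * ‖c‖ ^ 2) + 2 * (‖B - c * a‖ ^ 2 * ‖c'‖ ^ 2) := by
  have : A * c - B * c' = (A - c' * a) * c - (B - c * a) * c' := by ring
  rw [this, ← mul_pow, ← mul_pow, ← norm_mul, ← norm_mul]
  exact norm_sub_sq_le _ _

theorem norm_mul_sub_mul_acceptVec_le {Y F : Type*} (A B : ℂ) (ψ φ : Y → ℂ) (a : F → ℂ) (b : Bool) (y y' : Y)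
    (f : F) : ‖A * φ y - B * ψ y'‖ ^ 2 ≤ 2 * (‖A - acceptVec ψ a b y' f‖ ^ 2 * ‖φ y‖ ^ 2) +
      2 * (‖B - acceptVec φ a b y f‖ ^ 2 * ‖ψ y'‖ ^ 2) := by
  cases b
  · exact norm_mul_sub_mul_sq_le A B (φ y) (ψ y') (a f)
  · simpa [acceptVec] using norm_mul_sub_mul_sq_le A B (φ y) (ψ y') 0

/-- `A` stands for the verified state with message `ψ` and `B` for that with message `φ`. If both
have the same environment `a`, then holding `φ` beside `A` and exchanging the messages gives nearly
the state `B` with `ψ` beside it. The spare message enters each error term only through its total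
weight `1`. -/
theorem sum_nsq_mul_sub_mul_le {ψ : R → Y → ℂ} {φ : S → Y → ℂ} (hψ : ∑ r, nsq (ψ r) = 1)
    (hφ : ∑ s, nsq (φ s) = 1) (A : R → E → Bool → Y → F → ℂ) (B : S → E → Bool → Y → F → ℂ)
    (a : E → F → ℂ) :
    ∑ r, ∑ e, ∑ b, ∑ y, ∑ f, ∑ y', ∑ s, ‖A r e b y' f * φ s y - B s e b y f * ψ r y'‖ ^ 2 ≤
      2 * ∑ r, ∑ e, ∑ b, ∑ y, ∑ f, ‖A r e b y f - acceptVec (ψ r) (a e) b y f‖ ^ 2 +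
      2 * ∑ s, ∑ e, ∑ b, ∑ y, ∑ f, ‖B s e b y f - acceptVec (φ s) (a e) b y f‖ ^ 2 := by
  refine (Finset.sum_le_sum fun r _ => Finset.sum_le_sum fun e _ => Finset.sum_le_sum fun b _ =>
    Finset.sum_le_sum fun y _ => Finset.sum_le_sum fun f _ => Finset.sum_le_sum fun y' _ =>
    Finset.sum_le_sum fun s _ =>
      norm_mul_sub_mul_acceptVec_le (A r e b y' f) (B s e b y f) (ψ r) (φ s) (a e) b y y' f).trans
    (le_of_eq ?_)
  simp only [nsq] at hψ hφ
  rw [sum_two_mul_add_two_mul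
      (fun r e b y f y' s => ‖A r e b y' f - acceptVec (ψ r) (a e) b y' f‖ ^ 2 * ‖φ s y‖ ^ 2)
      (fun r e b y f y' s => ‖B s e b y f - acceptVec (φ s) (a e) b y f‖ ^ 2 * ‖ψ r y'‖ ^ 2),
    sum_mul_left_register (fun r e b y' f => ‖A r e b y' f - acceptVec (ψ r) (a e) b y' f‖ ^ 2)
      (fun s y => ‖φ s y‖ ^ 2),
    sum_mul_right_register (fun s e b y f => ‖B s e b y f - acceptVec (φ s) (a e) b y f‖ ^ 2)
      (fun r y => ‖ψ r y‖ ^ 2), hψ, hφ, mul_one, mul_one]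

end swap

theorem nsq_ketBra_mulVec_le {A : Type*} [Fintype A] {u : A → ℂ} (hu : nsq u = 1) (v : A → ℂ) :
    nsq (ketBra u *ᵥ v) ≤ nsq v := by
  have h1 : ketBra u *ᵥ v = fun i => (star u ⬝ᵥ v) * u i := by
    ext i
    simp [ketBra, Matrix.vecMulVec_mulVec, mul_comm]
  rw [h1, nsq_smul, hu, mul_one]
  have h2 := norm_dotProduct_le u v
  rw [hu, Real.sqrt_one, one_mul] at h2
  calc _ ≤ Real.sqrt (nsq v) ^ 2 := by gcongr
    _ = nsq v := Real.sq_sqrt (nsq_nonneg v)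

/-! ### Correctness makes the environment independent of the message -/

section disturbance
variable {k k' c m : ℕ} (G : QCircuit m k c) (V : QCircuit c k' (m + 1)) (sk : Qubits k)
  (vk : Qubits k')

/-- The amplitudes of the state before the discarded wires of `V` and `G` are traced out. -/
noncomputable def jointVec (ψ : Qubits m → ℂ) (e : Qubits (G.wires - c)) : Qubits V.wires → ℂ :=
  V.isometry vk *ᵥ (G.kraus sk e *ᵥ ψ)

theorem sum_nsq_jointVec (ψ : Qubits m → ℂ) : ∑ e, nsq (jointVec G V sk vk ψ e) = nsq ψ := by
  simp only [jointVec, nsq_mulVec_of_isometry (V.conjTranspose_isometry_mul vk)]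
  exact (G.hasKraus sk).sum_nsq ψ

/-- Two different vectors are allowed because the blocks of the output on message and reference
arise from off-diagonal inputs. -/
theorem readFlag_channel_channel_some (ψ φ : Qubits m → ℂ) (y y' : Qubits m) :
    (readFlag m ∘ₗ V.channel vk ∘ₗ G.channel sk) (Matrix.vecMulVec ψ (star φ)) (some y) (some y') =
      ∑ e, ∑ f, jointVec G V sk vk ψ e (joinWires (Fin.cons false y : Qubits (m + 1)) f) *
        star (jointVec G V sk vk φ e (joinWires (Fin.cons false y' : Qubits (m + 1)) f)) := by
  rw [LinearMap.comp_apply, readFlag_some_some, ((G.hasKraus sk).comp (V.hasKraus vk)).apply,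
    Matrix.sum_apply, Fintype.sum_prod_type]
  refine Finset.sum_congr rfl fun e _ => Finset.sum_congr rfl fun f _ => ?_
  rw [Matrix.mul_vecMulVec, Matrix.vecMulVec_mul, ← Matrix.star_mulVec, Matrix.vecMulVec_apply,
    ← Matrix.mulVec_mulVec, ← Matrix.mulVec_mulVec]
  rfl

theorem acceptMap_some_some (X : Matrix (Qubits m) (Qubits m) ℂ) (y y' : Qubits m) :
    acceptMap m X (some y) (some y') = X y y' := by
  simp [acceptMap, conjBy, Matrix.mul_apply]

/-- If `V` almost undoes `G`, then the state of the discarded wires is almost the same, and in a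
product state with the message, for all vectors of a family. -/
theorem exists_environment_fin {ν : ℝ} (hν : diamondNorm
      (readFlag m ∘ₗ V.channel vk ∘ₗ G.channel sk - acceptMap m) ≤ ENNReal.ofReal ν)
    {d : ℕ} {ξ : Fin d → Qubits m → ℂ} (hξ : ∑ t, nsq (ξ t) = 1) :
    ∃ a : Qubits (G.wires - c) → Qubits (V.wires - (m + 1)) → ℂ,
      ∑ t, ∑ e, ∑ b, ∑ y, ∑ f, ‖jointVec G V sk vk (ξ t) e
        (joinWires (Fin.cons b y : Qubits (m + 1)) f) - acceptVec (ξ t) (a e) b y f‖ ^ 2 ≤ |ν| := by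
  -- `ξ'` is the superposition of the `ξ t ⊗ |t⟩` with the label `t` in the reference register; `Ξ`
  -- is the same vector seen in the accepting subspace. Coherence between the labels is what forces
  -- one environment for all `t`.
  set ξ' : Qubits m × Fin d → ℂ := fun p => ξ p.2 p.1 with hξ'
  set Ξ : Option (Qubits m) × Fin d → ℂ := fun p => p.1.elim 0 (ξ p.2) with hΞ
  have hξ'1 : nsq ξ' = 1 := by
    rw [← hξ]
    simp only [nsq, Fintype.sum_prod_type, hξ']
    exact Finset.sum_comm
  have hΞ1 : nsq Ξ = 1 := by
    rw [← hξ'1]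
    simp [nsq, hΞ, hξ', Fintype.sum_prod_type]
  -- The test operator is the projector onto `Ξ`, so the trace below is a fidelity with the ideal
  -- output minus `1`.
  have h := norm_trace_mul_tensorId_le hν (posSemidef_ketBra ξ')
    (by rw [trace_ketBra, hξ'1, Complex.ofReal_one]) (nsq_ketBra_mulVec_le hΞ1)
  rw [Matrix.trace_mul_comm, trace_mul_ketBra] at h
  refine sum_nsq_sub_acceptVec_le hξ (fun t e b y f => jointVec G V sk vk (ξ t) e
    (joinWires (Fin.cons b y : Qubits (m + 1)) f)) ?_ (le_trans (le_of_eq_of_le ?_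
      (neg_le_abs _)) ((Complex.abs_re_le_norm _).trans h))
  · simp only [← hξ, ← sum_nsq_jointVec G V sk vk (ξ _)]
    simp only [nsq, sum_flag V.output_le]
  · set g : Fin d → Qubits (G.wires - c) → Qubits m → Qubits (V.wires - (m + 1)) → ℂ :=
      fun t e y f => jointVec G V sk vk (ξ t) e (joinWires (Fin.cons false y : Qubits (m + 1)) f)
      with hg
    -- The fidelity of the real output with `Ξ` is the sum over the environment of the squared
    -- overlaps; the ideal output contributes `nsq ξ' ^ 2`, which equals `1`.
    have key : star Ξ ⬝ᵥ (tensorId (Fin d)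
        (readFlag m ∘ₗ V.channel vk ∘ₗ G.channel sk - acceptMap m) (ketBra ξ') *ᵥ Ξ) =
        ∑ e, ∑ f, (∑ t, ∑ y, star (ξ t y) * g t e y f) *
          star (∑ t, ∑ y, star (ξ t y) * g t e y f) - (nsq ξ' : ℂ) * nsq ξ' := by
      have h1 : ∀ t t' y y', tensorId (Fin d)
          (readFlag m ∘ₗ V.channel vk ∘ₗ G.channel sk - acceptMap m) (ketBra ξ')
          (some y, t) (some y', t') =
          ∑ e, ∑ f, g t e y f * star (g t' e y' f) - ξ t y * star (ξ t' y') := by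
        intro t t' y y'
        change (readFlag m ∘ₗ V.channel vk ∘ₗ G.channel sk - acceptMap m)
          (Matrix.vecMulVec (ξ t) (star (ξ t'))) (some y) (some y') = _
        rw [LinearMap.sub_apply, Matrix.sub_apply, readFlag_channel_channel_some,
          acceptMap_some_some]
        rfl
      generalize tensorId (Fin d)
        (readFlag m ∘ₗ V.channel vk ∘ₗ G.channel sk - acceptMap m) (ketBra ξ') = X at h1
      have h2 : star Ξ ⬝ᵥ (X *ᵥ Ξ) = star ξ' ⬝ᵥ
          ((∑ e, ∑ f, ketBra (fun p => g p.2 e p.1 f) - ketBra ξ') *ᵥ ξ') := by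
        simp only [dotProduct, Matrix.mulVec, Fintype.sum_prod_type, Fintype.sum_option, hΞ, hξ',
          Pi.star_apply, Option.elim, star_zero, zero_mul, mul_zero, Finset.sum_const_zero,
          zero_add, h1, Matrix.sub_apply, Matrix.sum_apply, ketBra, Matrix.vecMulVec_apply]
      have h3 : ∀ u : Qubits m × Fin d → ℂ, star ξ' ⬝ᵥ (ketBra u *ᵥ ξ') =
          (star ξ' ⬝ᵥ u) * star (star ξ' ⬝ᵥ u) := by
        intro u
        rw [ketBra, Matrix.vecMulVec_mulVec, dotProduct_smul, Matrix.star_dotProduct u ξ']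
        rfl
      rw [h2, Matrix.sub_mulVec, dotProduct_sub, h3 ξ']
      simp only [Matrix.sum_mulVec, dotProduct_sum, h3]
      rw [← nsq_coe]
      congr 1
      · refine Finset.sum_congr rfl fun e _ => Finset.sum_congr rfl fun f _ => ?_
        simp only [dotProduct, Fintype.sum_prod_type_right, hξ', Pi.star_apply]
      · simp
    have h2 : star Ξ ⬝ᵥ (tensorId (Fin d)
        (readFlag m ∘ₗ V.channel vk ∘ₗ G.channel sk - acceptMap m) (ketBra ξ') *ᵥ Ξ) =
        ((∑ e, ∑ f, ‖∑ t, ∑ y, star (ξ t y) * g t e y f‖ ^ 2 - 1 : ℝ) : ℂ) := by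
      rw [key, hξ'1]
      push_cast
      simp only [Complex.star_def, Complex.mul_conj', one_mul]
    rw [h2, Complex.ofReal_re, neg_sub]

theorem exists_environment {ν : ℝ} (hν : diamondNorm
      (readFlag m ∘ₗ V.channel vk ∘ₗ G.channel sk - acceptMap m) ≤ ENNReal.ofReal ν)
    {T : Type*} [Fintype T] {ξ : T → Qubits m → ℂ} (hξ : ∑ t, nsq (ξ t) = 1) :
    ∃ a : Qubits (G.wires - c) → Qubits (V.wires - (m + 1)) → ℂ,
      ∑ t, ∑ e, ∑ b, ∑ y, ∑ f, ‖jointVec G V sk vk (ξ t) e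
        (joinWires (Fin.cons b y : Qubits (m + 1)) f) - acceptVec (ξ t) (a e) b y f‖ ^ 2 ≤ |ν| := by
  obtain ⟨a, ha⟩ := exists_environment_fin G V sk vk hν (ξ := ξ ∘ (Fintype.equivFin T).symm)
    (by rw [← hξ]; exact (Fintype.equivFin T).symm.sum_comp fun t => nsq (ξ t))
  refine ⟨a, le_of_eq_of_le ?_ ha⟩
  exact ((Fintype.equivFin T).symm.sum_comp fun t => ∑ e, ∑ b, ∑ y, ∑ f,
    ‖jointVec G V sk vk (ξ t) e (joinWires (Fin.cons b y : Qubits (m + 1)) f) -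
      acceptVec (ξ t) (a e) b y f‖ ^ 2).symm

theorem jointVec_smul (z : ℂ) (ψ : Qubits m → ℂ) (e : Qubits (G.wires - c)) :
    jointVec G V sk vk (fun y => z * ψ y) e = fun x => z * jointVec G V sk vk ψ e x := by
  have : (fun y => z * ψ y) = z • ψ := rfl
  rw [this, jointVec, Matrix.mulVec_smul, Matrix.mulVec_smul]
  rfl

theorem acceptVec_smul {Y F : Type*} (z : ℂ) (ψ : Y → ℂ) (a : F → ℂ) (b : Bool) (y : Y) (f : F) :
    acceptVec (fun y => z * ψ y) a b y f = z * acceptVec ψ a b y f := by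
  cases b <;> simp [acceptVec, mul_assoc]

/-- The state of the discarded wires is almost the same for two families of vectors. -/
theorem exists_common_environment {ν : ℝ} (hν : diamondNorm
      (readFlag m ∘ₗ V.channel vk ∘ₗ G.channel sk - acceptMap m) ≤ ENNReal.ofReal ν)
    {R S : Type*} [Fintype R] [Fintype S] {ψ : R → Qubits m → ℂ} {φ : S → Qubits m → ℂ}
    (hψ : ∑ r, nsq (ψ r) = 1) (hφ : ∑ s, nsq (φ s) = 1) :
    ∃ a : Qubits (G.wires - c) → Qubits (V.wires - (m + 1)) → ℂ,
      ∑ r, ∑ e, ∑ b, ∑ y, ∑ f, ‖jointVec G V sk vk (ψ r) e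
        (joinWires (Fin.cons b y : Qubits (m + 1)) f) - acceptVec (ψ r) (a e) b y f‖ ^ 2 +
      ∑ s, ∑ e, ∑ b, ∑ y, ∑ f, ‖jointVec G V sk vk (φ s) e
        (joinWires (Fin.cons b y : Qubits (m + 1)) f) - acceptVec (φ s) (a e) b y f‖ ^ 2 ≤
      2 * |ν| := by
  -- The two families, each of total weight `1`, are scaled by `1 / √2` and joined into one family
  -- of weight `1`. Undoing the scaling doubles the error.
  set z : ℂ := (((Real.sqrt 2)⁻¹ : ℝ) : ℂ)
  have hz : ‖z‖ ^ 2 = 1 / 2 := by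
    rw [Complex.norm_real, Real.norm_eq_abs, sq_abs, inv_pow, Real.sq_sqrt (by norm_num)]
    norm_num
  obtain ⟨a, ha⟩ := exists_environment G V sk vk hν
    (ξ := fun t : R ⊕ S => fun y => z * Sum.elim ψ φ t y) (by
      simp only [nsq_smul, ← Finset.mul_sum, Fintype.sum_sum_type, Sum.elim_inl, Sum.elim_inr,
        hψ, hφ, hz]
      norm_num)
  refine ⟨a, ?_⟩
  simp only [jointVec_smul, acceptVec_smul, ← mul_sub, norm_mul, mul_pow, hz, ← Finset.mul_sum,
    Fintype.sum_sum_type, Sum.elim_inl, Sum.elim_inr] at ha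
  linarith

end disturbance

/-! ### The attack -/

/-- The product of two vectors. -/
def tensorVec {w w' : ℕ} (f : Qubits w → ℂ) (g : Qubits w' → ℂ) : Qubits (w + w') → ℂ := fun z =>
  f (fun i => z (Fin.castAdd w' i)) * g (fun i => z (Fin.natAdd w i))

section tensorVec
variable {w w' : ℕ}

theorem tensorVec_append (f : Qubits w → ℂ) (g : Qubits w' → ℂ) (x : Qubits w) (x' : Qubits w') :
    tensorVec f g (Fin.append x x') = f x * g x' := by
  simp [tensorVec]

theorem exists_eq_append (z : Qubits (w + w')) : ∃ x x', z = Fin.append x x' :=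
  ⟨_, _, (Fin.append_castAdd_natAdd).symm⟩

theorem leftGates_mulVec (l : List (Gate w)) (Φ : Qubits (w + w') → ℂ) (x : Qubits w)
    (x' : Qubits w') : (gatesMatrix (leftGates w' l) *ᵥ Φ) (Fin.append x x') =
      (gatesMatrix l *ᵥ fun y => Φ (Fin.append y x')) x := by
  simp [Matrix.mulVec, dotProduct, sum_append, gatesMatrix_leftGates]

theorem leftGates_mulVec_tensorVec (l : List (Gate w)) (f : Qubits w → ℂ) (g : Qubits w' → ℂ) :
    gatesMatrix (leftGates w' l) *ᵥ tensorVec f g = tensorVec (gatesMatrix l *ᵥ f) g := by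
  funext z
  obtain ⟨x, x', rfl⟩ := exists_eq_append z
  rw [leftGates_mulVec]
  simp [tensorVec_append, Matrix.mulVec, dotProduct, Finset.sum_mul, mul_assoc]

theorem sum_append_real (F : Qubits (w + w') → ℝ) :
    ∑ z, F z = ∑ x : Qubits w, ∑ x' : Qubits w', F (Fin.append x x') := by
  rw [← Fintype.sum_prod_type', ← (Fin.appendEquiv (α := Bool) w w').sum_comp]
  rfl

theorem rightGates_mulVec_tensorVec (l : List (Gate w')) (f : Qubits w → ℂ) (g : Qubits w' → ℂ) :
    gatesMatrix (rightGates w l) *ᵥ tensorVec f g = tensorVec f (gatesMatrix l *ᵥ g) := by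
  funext z
  obtain ⟨x, x', rfl⟩ := exists_eq_append z
  simp [tensorVec_append, Matrix.mulVec, dotProduct, Finset.mul_sum, mul_left_comm, sum_append,
    gatesMatrix_rightGates]

theorem nsq_eq_sum_joinWires {b : ℕ} (h : b ≤ w) (F : Qubits w → ℂ) :
    nsq F = ∑ e, nsq fun y : Qubits b => F (joinWires y e) := by
  rw [nsq, sum_joinWires h, Finset.sum_comm]
  rfl

/-- The state of all wires at the start. -/
def initVec {a k : ℕ} (w : ℕ) (key : Qubits k) (u : Qubits a → ℂ) : Qubits w → ℂ := fun x =>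
  ∑ y, if x = initialState w key y then u y else 0

theorem isometry_mulVec {a k b : ℕ} (C : QCircuit a k b) (key : Qubits k) (u : Qubits a → ℂ) :
    C.isometry key *ᵥ u = gatesMatrix C.gates *ᵥ initVec C.wires key u := by
  ext x
  simp only [Matrix.mulVec, dotProduct, QCircuit.isometry, Matrix.of_apply, initVec,
    Finset.mul_sum, mul_ite, mul_zero]
  rw [Finset.sum_comm]
  simp

theorem initialState_add {a k : ℕ} (h : a + k ≤ w) (key : Qubits k) (y : Qubits a) :
    initialState (w + w') key y = Fin.append (initialState w key y) fun _ => false := by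
  ext i
  induction i using Fin.addCases with
  | left i => simp [initialState]
  | right i =>
    simp only [initialState, Fin.append_right, Fin.val_natAdd]
    rw [dif_neg (by omega), dif_neg (by omega)]

theorem initVec_add {a k : ℕ} (h : a + k ≤ w) (key : Qubits k) (u : Qubits a → ℂ) :
    initVec (w + w') key u = tensorVec (initVec w key u) (Pi.single (fun _ => false) 1) := by
  funext z
  obtain ⟨x, x', rfl⟩ := exists_eq_append z
  simp only [tensorVec_append, initVec, initialState_add h, append_inj_iff, Pi.single_apply,
    ite_and, Finset.sum_mul]
  refine Finset.sum_congr rfl fun y _ => ?_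
  split_ifs <;> simp

/-- The initial state of the wires that do not carry the quantum input. -/
def ancillaState {k : ℕ} (d : ℕ) (key : Qubits k) : Qubits d := fun i =>
  if h : i.val < k then key ⟨i.val, h⟩ else false

theorem initVec_joinWires {a k : ℕ} (h : a ≤ w) (key : Qubits k) (u : Qubits a → ℂ) (y : Qubits a)
    (e : Qubits (w - a)) :
    initVec w key u (joinWires y e) = if e = ancillaState (w - a) key then u y else 0 := by
  have h1 : ∀ y', joinWires y e = initialState w key y' ↔ y = y' ∧ e = ancillaState (w - a) key :=
    fun y' => ⟨fun hj => joinWires_inj h hj, fun hj => by rw [hj.1, hj.2]; rfl⟩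
  simp [initVec, h1, ite_and]

/-- The wires after the first `c` ones among `w + w'`. -/
def splitEquiv (c w w' : ℕ) (h : c ≤ w) :
    Qubits (w - c) × Qubits w' ≃ Qubits (w + w' - c) where
  toFun p i := if hi : i.val < w - c then p.1 ⟨i, hi⟩ else p.2 ⟨i - (w - c), by omega⟩
  invFun t := (fun i => t ⟨i, by omega⟩, fun i => t ⟨w - c + i, by omega⟩)
  left_inv p := by ext i <;> simp
  right_inv t := by
    ext i
    simp only
    split_ifs with hi
    · rfl
    · congr 1; ext; simp; omega

theorem joinWires_splitEquiv {c : ℕ} (h : c ≤ w) (y : Qubits c) (p : Qubits (w - c) × Qubits w') :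
    joinWires y (splitEquiv c w w' h p) = Fin.append (joinWires y p.1) p.2 := by
  ext i
  induction i using Fin.addCases with
  | left i =>
    simp only [joinWires, Fin.append_left, Fin.val_castAdd]
    split_ifs with hi
    · rfl
    · simp only [splitEquiv, Equiv.coe_fn_mk]
      rw [dif_pos (by omega)]
  | right i =>
    simp only [joinWires, Fin.append_right, Fin.val_natAdd]
    rw [dif_neg (by omega)]
    simp only [splitEquiv, Equiv.coe_fn_mk]
    rw [dif_neg (by omega)]
    exact congrArg p.2 (Fin.ext (by simp; omega))

end tensorVec

section attack
variable {c k k' m : ℕ}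

/-- The wires that carry the message in the output of `V`. -/
def messageWire (V : QCircuit c k' (m + 1)) (i : Fin m) : Fin V.wires :=
  ⟨i.val + 1, by have := V.output_le; omega⟩

/-- Undo the signature with `V`, replace the message by the output of `R`, apply `V` backwards. -/
def attackCircuit (V : QCircuit c k' (m + 1)) (R : QCircuit 0 0 m) : QCircuit c k' c where
  wires := V.wires + R.wires
  input_le := by have := V.input_le; omega
  output_le := by have := V.input_le; omega
  gates := leftGates R.wires V.gates ++ (rightGates V.wires R.gates ++
    (swapAll (fun i : Fin m => Fin.castAdd R.wires (messageWire V i))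
      (fun i => Fin.natAdd V.wires (i.castLE R.output_le))
      (fun i h => by simp [Fin.ext_iff, messageWire] at h; have := V.output_le; omega) ++
    leftGates R.wires (invGates V.gates)))

theorem swapAll_mulVec (V : QCircuit c k' (m + 1)) (R : QCircuit 0 0 m) (h)
    (Φ : Qubits (V.wires + R.wires) → ℂ) (b : Bool) (y y' : Qubits m)
    (f : Qubits (V.wires - (m + 1))) (s : Qubits (R.wires - m)) :
    (gatesMatrix (swapAll (fun i : Fin m => Fin.castAdd R.wires (messageWire V i))
      (fun i => Fin.natAdd V.wires (i.castLE R.output_le)) h) *ᵥ Φ)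
      (Fin.append (joinWires (Fin.cons b y : Qubits (m + 1)) f) (joinWires y' s)) =
    Φ (Fin.append (joinWires (Fin.cons b y' : Qubits (m + 1)) f) (joinWires y s)) := by
  obtain ⟨σ, h1, h2, h3, h4⟩ := gatesMatrix_swapAll
    (fun i : Fin m => Fin.castAdd R.wires (messageWire V i))
    (fun i => Fin.natAdd V.wires (i.castLE R.output_le))
    (fun i j hij => by simpa [Fin.ext_iff, messageWire] using hij)
    (fun i j hij => by simpa [Fin.ext_iff] using hij)
    (fun i j hij => by simp [Fin.ext_iff, messageWire] at hij; have := V.output_le; omega)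
  have key : (Fin.append (joinWires (Fin.cons b y' : Qubits (m + 1)) f) (joinWires y s)) ∘ σ =
      Fin.append (joinWires (Fin.cons b y : Qubits (m + 1)) f) (joinWires y' s) := by
    have hj : ∀ (y : Qubits m) (i : Fin m),
        joinWires (Fin.cons b y : Qubits (m + 1)) f (messageWire V i) = y i := by
      intro y i
      have hi : (messageWire V i).val < m + 1 := by simp [messageWire]
      exact (dif_pos hi).trans (Fin.cons_succ (α := fun _ => Bool) b y i)
    have hr : ∀ (y : Qubits m) (i : Fin m),
        joinWires y s (i.castLE R.output_le) = y i := by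
      intro y i
      simp [joinWires]
    ext j
    rw [Function.comp_apply]
    by_cases hj1 : j ∈ Set.range (fun i : Fin m => Fin.castAdd R.wires (messageWire V i))
    · obtain ⟨i, rfl⟩ := hj1
      simp only [h2, Fin.append_left, Fin.append_right, hj, hr]
    by_cases hj2 : j ∈ Set.range (fun i : Fin m => Fin.natAdd V.wires (i.castLE R.output_le))
    · obtain ⟨i, rfl⟩ := hj2
      simp only [h3, Fin.append_left, Fin.append_right, hj, hr]
    rw [h4 j hj1 hj2]
    induction j using Fin.addCases with
    | left i =>
      simp only [Fin.append_left, joinWires]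
      split_ifs with hi
      -- Of the first `m + 1` wires of `V` only wire `0`, the reject flag, does not carry the
      -- message; it is not swapped.
      · have h0 : i.val = 0 := by
          by_contra h0
          exact hj1 ⟨⟨i.val - 1, by omega⟩, by simp [Fin.ext_iff, messageWire]; omega⟩
        have : (⟨i.val, hi⟩ : Fin (m + 1)) = 0 := Fin.ext h0
        rw [this, Fin.cons_zero, Fin.cons_zero]
      · rfl
    | right i =>
      simp only [Fin.append_right, joinWires]
      split_ifs with hi
      · exact absurd ⟨⟨i.val, hi⟩, by simp⟩ hj2
      · rfl
  simp only [Matrix.mulVec, dotProduct, h1, ite_mul, one_mul, zero_mul]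
  rw [← key]
  have hinj : ∀ z z' : Qubits (V.wires + R.wires), z ∘ σ = z' ∘ σ ↔ z = z' := fun z z' =>
    ⟨fun h => σ.surjective.injective_comp_right h, fun h => by rw [h]⟩
  simp only [hinj, Finset.sum_ite_eq, Finset.mem_univ, if_true]

/-- The gates of `attackCircuit` that swap the message with the output of `R`. -/
def swapMessage (V : QCircuit c k' (m + 1)) (R : QCircuit 0 0 m) :
    List (Gate (V.wires + R.wires)) :=
  swapAll (fun i : Fin m => Fin.castAdd R.wires (messageWire V i))
    (fun i => Fin.natAdd V.wires (i.castLE R.output_le))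
    (fun i h => by simp [Fin.ext_iff, messageWire] at h; have := V.output_le; omega)

/-- The state of all wires at the end of `attackCircuit`. -/
noncomputable def attackVec (V : QCircuit c k' (m + 1)) (R : QCircuit 0 0 m) (vk : Qubits k')
    (u : Qubits c → ℂ) : Qubits (V.wires + R.wires) → ℂ :=
  (attackCircuit V R).isometry vk *ᵥ u

theorem attackVec_eq (V : QCircuit c k' (m + 1)) (R : QCircuit 0 0 m) (vk : Qubits k')
    (u : Qubits c → ℂ) : attackVec V R vk u =
      gatesMatrix (leftGates R.wires (invGates V.gates)) *ᵥ (gatesMatrix (swapMessage V R) *ᵥ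
        tensorVec (V.isometry vk *ᵥ u) R.finalVec) := by
  have h1 : attackVec V R vk u = gatesMatrix (leftGates R.wires V.gates ++
      (rightGates V.wires R.gates ++ (swapMessage V R ++ leftGates R.wires (invGates V.gates)))) *ᵥ
      initVec (V.wires + R.wires) vk u := isometry_mulVec _ vk u
  have h2 : gatesMatrix R.gates *ᵥ Pi.single (fun _ => false) 1 = R.finalVec := by
    ext x
    simp [QCircuit.finalVec]
  rw [h1, gatesMatrix_append, gatesMatrix_append, gatesMatrix_append, initVec_add V.input_le,
    ← Matrix.mulVec_mulVec, ← Matrix.mulVec_mulVec, ← Matrix.mulVec_mulVec,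
    leftGates_mulVec_tensorVec, rightGates_mulVec_tensorVec, ← isometry_mulVec, h2]

/-- Reapplying `V` cancels the backward run that ends the attack, leaving the verified state with
the two messages exchanged. -/
theorem leftGates_mulVec_attackVec (V : QCircuit c k' (m + 1)) (R : QCircuit 0 0 m)
    (vk : Qubits k') (u : Qubits c → ℂ) (b : Bool) (y y' : Qubits m)
    (f : Qubits (V.wires - (m + 1))) (s : Qubits (R.wires - m)) :
    (gatesMatrix (leftGates R.wires V.gates) *ᵥ attackVec V R vk u)
      (Fin.append (joinWires (Fin.cons b y : Qubits (m + 1)) f) (joinWires y' s)) =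
    (V.isometry vk *ᵥ u) (joinWires (Fin.cons b y' : Qubits (m + 1)) f) * R.component s y := by
  have h1 : gatesMatrix V.gates * (gatesMatrix V.gates)ᴴ = 1 :=
    mul_eq_one_comm.1 (conjTranspose_gatesMatrix_mul V.gates)
  rw [attackVec_eq, leftGates_mulVec]
  have h2 : ∀ Φ : Qubits (V.wires + R.wires) → ℂ, ∀ x', (fun x =>
      (gatesMatrix (leftGates R.wires (invGates V.gates)) *ᵥ Φ) (Fin.append x x')) =
      (gatesMatrix V.gates)ᴴ *ᵥ fun x => Φ (Fin.append x x') := by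
    intro Φ x'
    funext x
    rw [leftGates_mulVec, gatesMatrix_invGates]
  rw [h2, Matrix.mulVec_mulVec, h1, Matrix.one_mulVec, swapMessage, swapAll_mulVec,
    tensorVec_append]
  rfl

/-- The state that the attack approximates: a signature of the state `R` prepares, with the
message `ψ` on the wires of `R`. -/
noncomputable def idealVec (G : QCircuit m k c) (V : QCircuit c k' (m + 1)) (R : QCircuit 0 0 m)
    (sk : Qubits k) (vk : Qubits k') (ψ : Qubits m → ℂ) (e : Qubits (G.wires - c)) :
    Qubits (V.wires + R.wires) → ℂ := fun z =>
  initVec V.wires vk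
    (G.kraus sk e *ᵥ R.component ((joinEquiv R.output_le).symm fun i => z (Fin.natAdd _ i)).2)
    (fun i => z (Fin.castAdd _ i)) *
  ψ ((joinEquiv R.output_le).symm fun i => z (Fin.natAdd _ i)).1

variable (G : QCircuit m k c) (V : QCircuit c k' (m + 1)) (R : QCircuit 0 0 m)
    (sk : Qubits k) (vk : Qubits k')

theorem idealVec_append (ψ : Qubits m → ℂ) (e : Qubits (G.wires - c)) (x : Qubits V.wires)
    (y' : Qubits m) (s : Qubits (R.wires - m)) :
    idealVec G V R sk vk ψ e (Fin.append x (joinWires y' s)) =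
      initVec V.wires vk (G.kraus sk e *ᵥ R.component s) x * ψ y' := by
  have h : (joinEquiv R.output_le).symm (joinWires y' s) = (y', s) :=
    (joinEquiv R.output_le).symm_apply_apply (y', s)
  simp [idealVec, h]

theorem leftGates_mulVec_idealVec (ψ : Qubits m → ℂ) (e : Qubits (G.wires - c))
    (x : Qubits V.wires) (y' : Qubits m) (s : Qubits (R.wires - m)) :
    (gatesMatrix (leftGates R.wires V.gates) *ᵥ idealVec G V R sk vk ψ e)
      (Fin.append x (joinWires y' s)) = jointVec G V sk vk (R.component s) e x * ψ y' := by
  rw [leftGates_mulVec, jointVec, isometry_mulVec]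
  simp only [idealVec_append, Matrix.mulVec, dotProduct, Finset.sum_mul, mul_assoc]

/-- After the unitary of `V` is applied to both vectors, the first becomes the swapped product and
the second the verified signature of `R` with `ψ` beside it. The exchange estimate for a common
environment applies and gives `2 * (2 * |ν|)`. -/
theorem sum_nsq_sub_idealVec_le {ν : ℝ} (hν : diamondNorm
      (readFlag m ∘ₗ V.channel vk ∘ₗ G.channel sk - acceptMap m) ≤ ENNReal.ofReal ν)
    {T : Type*} [Fintype T] {ψ : T → Qubits m → ℂ} (hψ : ∑ r, nsq (ψ r) = 1) :
    ∑ r, ∑ e, nsq (fun z : Qubits (V.wires + R.wires) =>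
      attackVec V R vk (G.kraus sk e *ᵥ ψ r) z -
      idealVec G V R sk vk (ψ r) e z) ≤ 4 * |ν| := by
  obtain ⟨a, ha⟩ := exists_common_environment G V sk vk hν hψ R.sum_nsq_component
  have h := sum_nsq_mul_sub_mul_le hψ R.sum_nsq_component
    (fun r e b y f => jointVec G V sk vk (ψ r) e (joinWires (Fin.cons b y : Qubits (m + 1)) f))
    (fun s e b y f => jointVec G V sk vk (R.component s) e
      (joinWires (Fin.cons b y : Qubits (m + 1)) f)) a
  refine le_trans (le_of_eq ?_) (h.trans (by linarith))
  refine Finset.sum_congr rfl fun r _ => Finset.sum_congr rfl fun e _ => ?_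
  rw [← nsq_mulVec_of_isometry (conjTranspose_gatesMatrix_mul (leftGates R.wires V.gates))]
  have : (fun z : Qubits (V.wires + R.wires) =>
      attackVec V R vk (G.kraus sk e *ᵥ ψ r) z -
      idealVec G V R sk vk (ψ r) e z) =
      attackVec V R vk (G.kraus sk e *ᵥ ψ r) -
      idealVec G V R sk vk (ψ r) e := rfl
  rw [this, Matrix.mulVec_sub, nsq, sum_append_real, sum_flag V.output_le]
  refine Finset.sum_congr rfl fun b _ => Finset.sum_congr rfl fun y _ =>
    Finset.sum_congr rfl fun f _ => ?_
  rw [sum_joinWires R.output_le]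
  refine Finset.sum_congr rfl fun y' _ => Finset.sum_congr rfl fun s _ => ?_
  rw [Pi.sub_apply, leftGates_mulVec_attackVec, leftGates_mulVec_idealVec]
  rfl

/-- Any event that the adversary's output triggers is almost as unlikely as for a signature of the
state that `R` prepares. -/
theorem sum_event_attackCircuit_le {ν : ℝ} (hν : diamondNorm
      (readFlag m ∘ₗ V.channel vk ∘ₗ G.channel sk - acceptMap m) ≤ ENNReal.ofReal ν)
    {T : Type*} [Fintype T] {ψ : T → Qubits m → ℂ} (hψ : ∑ r, nsq (ψ r) = 1)
    {q : (Qubits c → ℂ) → ℝ} (hq0 : ∀ z u, q (fun y => u y * z) = ‖z‖ ^ 2 * q u)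
    (hq : ∀ u v, q u ≤ 2 * q v + 2 * nsq (fun y => u y - v y)) :
    ∑ r, ∑ e, ∑ t, q ((attackCircuit V R).kraus vk t *ᵥ (G.kraus sk e *ᵥ ψ r)) ≤
      2 * ∑ s, ∑ e, q (G.kraus sk e *ᵥ R.component s) + 8 * |ν| := by
  have hc : c ≤ V.wires := by have := V.input_le; omega
  have h1 : ∀ r e, ∑ t, q ((attackCircuit V R).kraus vk t *ᵥ (G.kraus sk e *ᵥ ψ r)) ≤
      2 * (nsq (ψ r) * ∑ s, q (G.kraus sk e *ᵥ R.component s)) +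
      2 * nsq (fun z : Qubits (V.wires + R.wires) =>
        attackVec V R vk (G.kraus sk e *ᵥ ψ r) z -
        idealVec G V R sk vk (ψ r) e z) := by
    intro r e
    -- The discarded wires are the workspace of `V` and the wires of `R`, the latter split into the
    -- displaced message `y'` and the leftover `s` of the preparation. In the ideal state the
    -- workspace is back in its initial basis state, so only one value of `mid` contributes.
    have h2 : ∑ t, q (fun y => idealVec G V R sk vk (ψ r) e (joinWires y t)) =
        nsq (ψ r) * ∑ s, q (G.kraus sk e *ᵥ R.component s) := by
      rw [← (splitEquiv c V.wires R.wires hc).sum_comp, Fintype.sum_prod_type]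
      simp only [joinWires_splitEquiv hc]
      have h3 : ∀ mid : Qubits (V.wires - c), ∀ y' s,
          q (fun y => idealVec G V R sk vk (ψ r) e
            (Fin.append (joinWires y mid) (joinWires y' s))) =
          if mid = ancillaState (V.wires - c) vk then
            ‖ψ r y'‖ ^ 2 * q (G.kraus sk e *ᵥ R.component s) else 0 := by
        intro mid y' s
        simp only [idealVec_append, initVec_joinWires hc]
        split_ifs with h
        · exact hq0 _ _
        · simpa using hq0 0 fun _ => 0
      simp only [sum_joinWires R.output_le, h3]
      simp only [Finset.sum_ite_irrel, Finset.sum_const_zero, Finset.sum_ite_eq', Finset.mem_univ,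
        if_true, nsq, Finset.sum_mul, Finset.mul_sum]
      exact Finset.sum_comm
    rw [← h2, nsq_eq_sum_joinWires (b := c) (w := V.wires + R.wires) (by omega), Finset.mul_sum,
      Finset.mul_sum, ← Finset.sum_add_distrib]
    exact Finset.sum_le_sum fun t _ => hq _ _
  have h4 := sum_nsq_sub_idealVec_le G V R sk vk hν hψ
  refine (Finset.sum_le_sum fun r _ => Finset.sum_le_sum fun e _ => h1 r e).trans ?_
  simp only [Finset.sum_add_distrib, ← Finset.mul_sum, ← Finset.sum_mul, hψ, one_mul]
  rw [Finset.sum_comm (f := fun s e => q (G.kraus sk e *ᵥ R.component s))]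
  linarith

end attack

/-! ### Success of the attack -/

/-- Exhibits the probability of an event as a sum of squared norms, from which homogeneity and the
triangle inequality for unnormalised vectors follow. -/
theorem HasKraus.event_ketBra {A B ι : Type*} [Fintype A] [DecidableEq A] [Fintype B]
    [DecidableEq B] [Fintype ι] {Φ : Matrix A A ℂ →ₗ[ℂ] Matrix B B ℂ} {K : ι → Matrix B A ℂ}
    (h : HasKraus Φ K) {Q : Matrix B B ℂ} (hQ : IsStarProjection Q) (u : A → ℂ) :
    (Q * Φ (ketBra u)).trace.re = ∑ i, nsq (Q *ᵥ (K i *ᵥ u)) := by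
  have : (Q * Φ (ketBra u)).trace = ((∑ i, nsq (Q *ᵥ (K i *ᵥ u)) : ℝ) : ℂ) := by
    rw [h.apply_ketBra, Matrix.mul_sum, Matrix.trace_sum]
    push_cast
    simp only [trace_mul_ketBra, nsq_mulVec_of_isStarProjection hQ]
  rw [this, Complex.ofReal_re]

theorem HasKraus.event_scale {A B ι : Type*} [Fintype A] [DecidableEq A] [Fintype B]
    [DecidableEq B] [Fintype ι] {Φ : Matrix A A ℂ →ₗ[ℂ] Matrix B B ℂ} {K : ι → Matrix B A ℂ}
    (h : HasKraus Φ K) {Q : Matrix B B ℂ} (hQ : IsStarProjection Q) (z : ℂ) (u : A → ℂ) :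
    (Q * Φ (ketBra fun y => u y * z)).trace.re = ‖z‖ ^ 2 * (Q * Φ (ketBra u)).trace.re := by
  have hu : (fun y => u y * z) = z • u := by ext; simp [mul_comm]
  rw [h.event_ketBra hQ, h.event_ketBra hQ, hu, Finset.mul_sum]
  simp only [Matrix.mulVec_smul, ← nsq_smul]
  rfl

/-- Squared triangle inequality. The factor `2` does no harm, as only events of almost zero
probability are transferred. -/
theorem HasKraus.event_le {A B ι : Type*} [Fintype A] [DecidableEq A] [Fintype B]
    [DecidableEq B] [Fintype ι] {Φ : Matrix A A ℂ →ₗ[ℂ] Matrix B B ℂ} {K : ι → Matrix B A ℂ}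
    (h : HasKraus Φ K) {Q : Matrix B B ℂ} (hQ : IsStarProjection Q) (u v : A → ℂ) :
    (Q * Φ (ketBra u)).trace.re ≤
      2 * (Q * Φ (ketBra v)).trace.re + 2 * nsq (fun y => u y - v y) := by
  rw [h.event_ketBra hQ, h.event_ketBra hQ, ← h.sum_nsq (fun y => u y - v y), Finset.mul_sum,
    Finset.mul_sum, ← Finset.sum_add_distrib]
  refine Finset.sum_le_sum fun i _ => ?_
  have h1 : (fun y => u y - v y) = u - v := rfl
  have h2 : Q *ᵥ (K i *ᵥ u) = fun j => (Q *ᵥ (K i *ᵥ v)) j + (Q *ᵥ (K i *ᵥ (u - v))) j := by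
    ext j
    simp [Matrix.mulVec_sub]
  rw [h1, h2]
  refine (nsq_add_le _ _).trans ?_
  linarith [nsq_mulVec_le_of_isStarProjection hQ (K i *ᵥ (u - v))]

namespace QSignature
variable (S : QSignature) (n : ℕ)

theorem keyProb_nonneg (sk : Qubits (S.s n)) (vk : Qubits (S.v n)) : 0 ≤ S.keyProb n sk vk := by
  rw [keyProb, QCircuit.outputState_eq, Matrix.sum_apply, Complex.re_sum]
  refine Finset.sum_nonneg fun e _ => ?_
  rw [ketBra, Matrix.vecMulVec_apply, Pi.star_apply, Complex.star_def, Complex.mul_conj]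
  simpa using Complex.normSq_nonneg _

theorem sum_keyProb : ∑ sk, ∑ vk, S.keyProb n sk vk = 1 := by
  have h := congrArg Complex.re (S.keyGen n).trace_outputState
  rw [Matrix.trace, Complex.re_sum, sum_append_real] at h
  exact h

theorem hasKraus_verChannel (vk : Qubits (S.v n)) : HasKraus (S.verChannel n vk)
    fun p : Qubits ((S.ver n).wires - (S.m n + 1)) × Qubits (S.m n) =>
      flagKraus (S.m n) p.2 * (S.ver n).kraus vk p.1 :=
  ((S.ver n).hasKraus vk).comp (hasKraus_readFlag _)

theorem trace_attackMap (adv : QCircuit (S.c n) (S.v n) (S.c n))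
    (X : Matrix (Qubits (S.m n)) (Qubits (S.m n)) ℂ) : (S.attackMap n adv X).trace = X.trace := by
  have h1 : ∀ sk vk, ((S.verChannel n vk ∘ₗ adv.channel vk ∘ₗ (S.sign n).channel sk) X).trace =
      X.trace := fun sk vk =>
    ((((S.sign n).hasKraus sk).comp (adv.hasKraus vk)).comp (S.hasKraus_verChannel n vk)).trace_eq X
  have h2 : ((∑ sk, ∑ vk, S.keyProb n sk vk : ℝ) : ℂ) = 1 := by rw [S.sum_keyProb n]; simp
  simp only [attackMap, LinearMap.sum_apply, LinearMap.smul_apply, Matrix.trace_sum,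
    Matrix.trace_smul, h1, smul_eq_mul, ← Finset.sum_mul]
  push_cast at h2
  rw [h2, one_mul]

variable {S n}

/-- The attacked state behaves like an honest signature of `R`, with error `8 * |ν|`. Correctness
replaces the verification of that signature by the state of `R` itself; this error `|ν|` is doubled
by the factor `2` in front. -/
theorem event_attack_le {ν : ℝ} {sk : Qubits (S.s n)} {vk : Qubits (S.v n)}
    (hν : diamondNorm (S.verChannel n vk ∘ₗ (S.sign n).channel sk - acceptMap (S.m n)) ≤
      ENNReal.ofReal ν) (R R' : QCircuit 0 0 (S.m n))
    {Q : Matrix (Option (Qubits (S.m n))) (Option (Qubits (S.m n))) ℂ} (hQ : IsStarProjection Q) :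
    (Q * (S.verChannel n vk ∘ₗ (attackCircuit (S.ver n) R).channel vk ∘ₗ (S.sign n).channel sk)
      R'.outputState).trace.re ≤ 2 * (Q * acceptMap _ R.outputState).trace.re + 10 * |ν| := by
  have hV := S.hasKraus_verChannel n vk
  have hG := (S.sign n).hasKraus sk
  have hA := (attackCircuit (S.ver n) R).hasKraus vk
  have h1 := sum_event_attackCircuit_le (S.sign n) (S.ver n) R sk vk hν R'.sum_nsq_component
    (q := fun u => (Q * S.verChannel n vk (ketBra u)).trace.re) (hV.event_scale hQ) (hV.event_le hQ)
  have h2 : (Q * (S.verChannel n vk ∘ₗ (attackCircuit (S.ver n) R).channel vk ∘ₗ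
      (S.sign n).channel sk) R'.outputState).trace.re =
      ∑ r, ∑ e, ∑ t, (Q * S.verChannel n vk (ketBra ((attackCircuit (S.ver n) R).kraus vk t *ᵥ
        ((S.sign n).kraus sk e *ᵥ R'.component r)))).trace.re := by
    simp only [R'.outputState_eq, LinearMap.comp_apply, map_sum, hG.apply_ketBra, hA.apply_ketBra,
      Matrix.mul_sum, Matrix.trace_sum, Complex.re_sum]
  have h3 : (Q * (S.verChannel n vk ∘ₗ (S.sign n).channel sk) R.outputState).trace.re =
      ∑ s, ∑ e, (Q * S.verChannel n vk
        (ketBra ((S.sign n).kraus sk e *ᵥ R.component s))).trace.re := by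
    simp only [R.outputState_eq, LinearMap.comp_apply, map_sum, hG.apply_ketBra,
      Matrix.mul_sum, Matrix.trace_sum, Complex.re_sum]
  have h4 := norm_trace_mul_apply_le hν R.posSemidef_outputState R.trace_outputState
    (nsq_mulVec_le_of_isStarProjection hQ)
  rw [LinearMap.sub_apply, Matrix.mul_sub, Matrix.trace_sub] at h4
  have h5 := (Complex.re_le_norm _).trans h4
  rw [Complex.sub_re, h3] at h5
  rw [h2]
  linarith

theorem event_attackMap_le {ν : ℝ} (hν : ∀ sk vk, 0 < S.keyProb n sk vk →
      diamondNorm (S.verChannel n vk ∘ₗ (S.sign n).channel sk - acceptMap (S.m n)) ≤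
        ENNReal.ofReal ν) (R R' : QCircuit 0 0 (S.m n))
    {Q : Matrix (Option (Qubits (S.m n))) (Option (Qubits (S.m n))) ℂ} (hQ : IsStarProjection Q) :
    (Q * S.attackMap n (attackCircuit (S.ver n) R) R'.outputState).trace.re ≤
      2 * (Q * acceptMap _ R.outputState).trace.re + 10 * |ν| := by
  simp only [attackMap, LinearMap.sum_apply, LinearMap.smul_apply, Matrix.mul_sum,
    Matrix.trace_sum, Matrix.mul_smul, Matrix.trace_smul, Complex.re_sum, smul_eq_mul,
    Complex.re_ofReal_mul]
  calc _ ≤ ∑ sk, ∑ vk, S.keyProb n sk vk *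
        (2 * (Q * acceptMap _ R.outputState).trace.re + 10 * |ν|) := by
        refine Finset.sum_le_sum fun sk _ => Finset.sum_le_sum fun vk _ => ?_
        -- Correctness says nothing about keys of probability zero, and these have no weight in the
        -- average.
        rcases (S.keyProb_nonneg n sk vk).eq_or_lt with h | h
        · simp [← h]
        · exact mul_le_mul_of_nonneg_left (event_attack_le (hν sk vk h) R R' hQ) h.le
    _ = _ := by simp only [← Finset.sum_mul, S.sum_keyProb n, one_mul]

end QSignature

/-- The observable with values `1` and `-1` turns the measurement channel into the bias `Pr[0] -
Pr[1]`. As a contraction it detects distances up to `2`, the full range of the unnormalised norm. -/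
theorem trace_signs_mul_channel {A : Type} [Fintype A] [DecidableEq A] (L : TwoOutcome A)
    (X : Matrix A A ℂ) :
    (Matrix.diagonal ![1, -1] * L.channel X).trace = X.trace - 2 * (L.P * X).trace := by
  simp only [TwoOutcome.channel, Matrix.trace_fin_two, Matrix.diagonal_mul, LinearMap.add_apply,
    LinearMap.smulRight_apply, Matrix.add_apply, Matrix.smul_apply, LinearMap.comp_apply,
    LinearMap.mulLeft_apply, Matrix.traceLinearMap_apply, Matrix.sub_mul, Matrix.one_mul,
    Matrix.trace_sub]
  simp
  ring

theorem trace_acceptMap (m : ℕ) (X : Matrix (Qubits m) (Qubits m) ℂ) :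
    (acceptMap m X).trace = X.trace := by
  have h : acceptMap m X none none = 0 := by simp [acceptMap, conjBy, Matrix.mul_apply]
  simp [Matrix.trace, Fintype.sum_option, acceptMap_some_some, h]

theorem TwoOutcome.re_P_mem {A : Type} [Fintype A] [DecidableEq A] (L : TwoOutcome A) (i : A) :
    0 ≤ (L.P i i).re ∧ (L.P i i).re ≤ 1 := by
  have h1 : ∀ {Q : Matrix A A ℂ}, IsStarProjection Q → 0 ≤ (Q i i).re := by
    intro Q hQ
    have h := nsq_mulVec_of_isStarProjection hQ (Pi.single i 1)
    have h2 : star (Pi.single i (1 : ℂ)) ⬝ᵥ (Q *ᵥ Pi.single i 1) = Q i i := by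
      simp [dotProduct, Pi.single_apply]
    rw [h2] at h
    rw [← h, Complex.ofReal_re]
    exact nsq_nonneg _
  refine ⟨h1 L.isProj, ?_⟩
  have := h1 L.isProj.one_sub
  simp at this
  linarith

namespace QSignature
variable {S : QSignature} {n : ℕ}

/-- The bias of the outcome distinguishes an attack from the ideal behaviour. -/
theorem abs_bias_le {M : S.Measurement} {adv : QCircuit (S.c n) (S.v n) (S.c n)} {ε : ℝ≥0} {p : ℝ}
    (h : diamondNorm ((M n).channel ∘ₗ S.attackMap n adv -
        ((p : ℂ) • ((M n).channel ∘ₗ acceptMap (S.m n)) +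
          ((1 - p : ℝ) : ℂ) • ((M n).channel ∘ₗ rejectMap (S.m n)))) ≤ (ε : ℝ≥0∞))
    (R : QCircuit 0 0 (S.m n)) :
    |1 - 2 * ((M n).P * S.attackMap n adv R.outputState).trace.re -
      p * (1 - 2 * S.outcomeProb M n R.outputState) -
      (1 - p) * (1 - 2 * ((M n).P none none).re)| ≤ ε := by
  rw [← ENNReal.ofReal_coe_nnreal] at h
  have h1 := norm_trace_mul_apply_le h R.posSemidef_outputState R.trace_outputState
    (Q := Matrix.diagonal ![1, -1]) (fun v => by
      simp [nsq, Matrix.mulVec_diagonal])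
  have h2 := (Complex.abs_re_le_norm _).trans h1
  have h3 : (rejectMap (S.m n) R.outputState).trace = 1 := by
    simp [rejectMap, R.trace_outputState]
  have h4 : ((M n).P * rejectMap (S.m n) R.outputState).trace = (M n).P none none := by
    simp [rejectMap, R.trace_outputState, Matrix.trace_mul_single]
  simp only [LinearMap.sub_apply, LinearMap.add_apply, LinearMap.smul_apply, LinearMap.comp_apply,
    Matrix.mul_sub, Matrix.mul_add, Matrix.mul_smul, Matrix.trace_sub, Matrix.trace_add,
    Matrix.trace_smul, trace_signs_mul_channel, S.trace_attackMap, trace_acceptMap,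
    R.trace_outputState, h3, h4, smul_eq_mul, Complex.sub_re, Complex.add_re,
    Complex.re_ofReal_mul, Complex.one_re, NNReal.abs_eq] at h2
  simpa [outcomeProb, sub_sub, add_assoc] using h2

/-- Up to errors the two bias inequalities read `2 * (p₀ + (1 - p₀) * π) ≤ ε` and `2 * (p₁ + (1 -
p₁) * (1 - π)) ≤ ε`, where `π` is the probability of outcome `1` on `⊥`. Their left sides are at
least `2π` and `2(1 - π)`. The error is `2 * (2 * |ν'| + 10 * |ν|)` from the attack and `2 * |ν'|`
from the ideal map. -/
theorem one_sub_le_of_attack {M : S.Measurement} {ν ν' : ℝ}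
    (hν : ∀ sk vk, 0 < S.keyProb n sk vk →
      diamondNorm (S.verChannel n vk ∘ₗ (S.sign n).channel sk - acceptMap (S.m n)) ≤
        ENNReal.ofReal ν) {R₀ R₁ : QCircuit 0 0 (S.m n)}
    (h₀ : S.outcomeProb M n R₀.outputState ≤ ν') (h₁ : 1 - ν' ≤ S.outcomeProb M n R₁.outputState)
    {ε : ℝ≥0} {p₀ p₁ : ℝ} (hp₀ : p₀ ∈ Set.Icc (0 : ℝ) 1) (hp₁ : p₁ ∈ Set.Icc (0 : ℝ) 1)
    (hd₀ : diamondNorm ((M n).channel ∘ₗ S.attackMap n (attackCircuit (S.ver n) R₀) -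
        ((p₀ : ℂ) • ((M n).channel ∘ₗ acceptMap (S.m n)) +
          ((1 - p₀ : ℝ) : ℂ) • ((M n).channel ∘ₗ rejectMap (S.m n)))) ≤ (ε : ℝ≥0∞))
    (hd₁ : diamondNorm ((M n).channel ∘ₗ S.attackMap n (attackCircuit (S.ver n) R₁) -
        ((p₁ : ℂ) • ((M n).channel ∘ₗ acceptMap (S.m n)) +
          ((1 - p₁ : ℝ) : ℂ) • ((M n).channel ∘ₗ rejectMap (S.m n)))) ≤ (ε : ℝ≥0∞)) :
    1 - (6 * |ν'| + 20 * |ν|) ≤ (ε : ℝ) ∧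
      ((M n).P none none = 0 ∨ (M n).P none none = 1 → 2 - (6 * |ν'| + 20 * |ν|) ≤ (ε : ℝ)) := by
  -- The message of `R₁` is attacked with `R₀` and conversely. The sign of the absolute value is
  -- chosen according to the direction in which the attack moves the outcome.
  have hb₀ := (le_abs_self _).trans (abs_bias_le hd₀ R₁)
  have hb₁ := (neg_le_abs _).trans (abs_bias_le hd₁ R₀)
  have he₀ := event_attackMap_le hν R₀ R₁ (M n).isProj
  have he₁ := event_attackMap_le hν R₁ R₀ (M n).isProj.one_sub
  rw [Matrix.sub_mul, Matrix.one_mul, Matrix.trace_sub, S.trace_attackMap, R₀.trace_outputState,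
    Matrix.sub_mul, Matrix.one_mul, Matrix.trace_sub, trace_acceptMap, R₁.trace_outputState,
    Complex.sub_re, Complex.sub_re, Complex.one_re] at he₁
  rw [outcomeProb] at hb₀ hb₁ h₀ h₁
  set π := ((M n).P none none).re with hπ
  obtain ⟨hπ0, hπ1⟩ := (M n).re_P_mem none
  obtain ⟨hp0, hp1⟩ := hp₀
  obtain ⟨hq0, hq1⟩ := hp₁
  have hv := le_abs_self ν'
  have hv0 := abs_nonneg ν'
  set o₀ := ((M n).P * acceptMap (S.m n) R₀.outputState).trace.re
  set o₁ := ((M n).P * acceptMap (S.m n) R₁.outputState).trace.re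
  have k₀ : p₀ * (1 - 2 * o₁) ≤ - p₀ + 2 * |ν'| := by nlinarith
  have k₁ : p₁ - 2 * |ν'| ≤ p₁ * (1 - 2 * o₀) := by nlinarith
  refine ⟨?_, ?_⟩
  -- The attack with `R₁` decides when `⊥` leans towards outcome `0`, the attack with `R₀` when it
  -- leans towards `1`.
  · rcases le_total π (1 / 2) with h | h
    · nlinarith
    · nlinarith
  · rintro (h | h)
    · have : π = 0 := by rw [hπ, h]; simp
      rw [this] at hb₁
      linarith
    · have : π = 1 := by rw [hπ, h]; simp
      rw [this] at hb₀
      linarith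

/-- Takes the efficiency of the attack as the hypothesis `hq`, separating the quantum argument from
the machine model. The error depends only on the functions from correctness and non-triviality, so
it serves every `ε`. -/
theorem exists_negligible_of_isQPT (hS : S.Correct) {M : S.Measurement} (hM : S.NonTrivial M)
    (hq : ∀ R : ∀ n, QCircuit 0 0 (S.m n), IsQPT R → IsQPT fun n => attackCircuit (S.ver n) (R n)) :
    ∃ ν : ℕ → ℝ, Negligible ν ∧ ∀ ε : ℕ → ℝ≥0, S.OneTimeSecure ε {M} →
      ∀ n, 1 - ν n ≤ (ε n : ℝ) ∧
        ((M n).P none none = 0 ∨ (M n).P none none = 1 → 2 - ν n ≤ (ε n : ℝ)) := by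
  obtain ⟨ν, hν, hν'⟩ := hS
  obtain ⟨R₀, R₁, hR₀, hR₁, ν', hn, hn'⟩ := hM
  have habs : ∀ {f : ℕ → ℝ}, Negligible f → Negligible fun n => |f n| := fun {f} hf k => by
    have := (hf k).abs
    simpa [abs_mul] using this
  refine ⟨fun n => 6 * |ν' n| + 20 * |ν n|, ((habs hn).const_mul 6).add ((habs hν).const_mul 20),
    fun ε hε n => ?_⟩
  obtain ⟨p₀, h₀⟩ := hε _ (hq R₀ hR₀) M rfl
  obtain ⟨p₁, h₁⟩ := hε _ (hq R₁ hR₁) M rfl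
  exact one_sub_le_of_attack (hν' n) (hn' n).1 (hn' n).2 (h₀ n).1 (h₁ n).1 (h₀ n).2 (h₁ n).2

end QSignature

/-! ### Programs -/

namespace Prog

/-- Started on `s`, the program `p` halts in the state `s'` after at most `B` steps. -/
def Within (p : Prog) (s : ℕ → List Bool) (B : ℕ) (s' : ℕ → List Bool) : Prop :=
  ∃ t ≤ B, p.Runs s t s'

namespace Within
variable {p q e : Prog} {s s' s'' : ℕ → List Bool} {B B' : ℕ} {r : ℕ}

theorem congr (h : p.Within s B s') (hs : s' = s'') (hB : B ≤ B') : p.Within s B' s'' := by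
  obtain ⟨t, ht, h⟩ := h
  exact ⟨t, ht.trans hB, hs ▸ h⟩

theorem push (b : Bool) (r : ℕ) (s : ℕ → List Bool) :
    (Prog.push b r).Within s 1 (Function.update s r (b :: s r)) := ⟨1, le_rfl, .push b r s⟩

theorem pop (r : ℕ) (s : ℕ → List Bool) :
    (Prog.pop r).Within s 1 (Function.update s r (s r).tail) := ⟨1, le_rfl, .pop r s⟩

theorem seq (hp : p.Within s B s') (hq : q.Within s' B' s'') :
    (Prog.seq p q).Within s (B + B') s'' := by
  obtain ⟨t, ht, hp⟩ := hp
  obtain ⟨t', ht', hq⟩ := hq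
  exact ⟨t + t', by omega, hp.seq hq⟩

theorem branch_true (hr : (s r).head? = some true) (h : p.Within s B s') :
    (Prog.branch r p q e).Within s (B + 1) s' := by
  obtain ⟨t, ht, h⟩ := h
  exact ⟨t + 1, by omega, .branch_true hr h⟩

theorem branch_false (hr : (s r).head? = some false) (h : q.Within s B s') :
    (Prog.branch r p q e).Within s (B + 1) s' := by
  obtain ⟨t, ht, h⟩ := h
  exact ⟨t + 1, by omega, .branch_false hr h⟩

theorem loop_done (hr : s r = []) : (Prog.loop r p).Within s 1 s := ⟨1, le_rfl, .loop_done hr⟩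

theorem loop_step (hr : s r ≠ []) (hp : p.Within s B s')
    (h : (Prog.loop r p).Within s' B' s'') : (Prog.loop r p).Within s (B + B' + 1) s'' := by
  obtain ⟨t, ht, hp⟩ := hp
  obtain ⟨t', ht', h⟩ := h
  exact ⟨t + t' + 1, by omega, .loop_step hr hp h⟩

end Within

/-- A step adds at most one bit, so outputs of polynomial-time programs have polynomial length. -/
theorem Runs.length_le {p : Prog} {s s' : ℕ → List Bool} {t : ℕ} (h : p.Runs s t s') (r : ℕ) :
    (s' r).length ≤ (s r).length + t := by
  induction h with
  | push b r' s =>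
    rcases eq_or_ne r r' with rfl | h
    · simp
    · simp [h]
  | pop r' s =>
    rcases eq_or_ne r r' with rfl | h
    · simp; omega
    · simp [h]
  | seq _ _ ih ih' => omega
  | branch_true _ _ ih => omega
  | branch_false _ _ ih => omega
  | branch_empty _ _ ih => omega
  | loop_done _ => omega
  | loop_step _ _ _ ih ih' => omega

/-- The same program on relabelled stacks. -/
def rename (f : ℕ → ℕ) : Prog → Prog
  | push b r => push b (f r)
  | pop r => pop (f r)
  | seq p q => seq (p.rename f) (q.rename f)
  | branch r p q e => branch (f r) (p.rename f) (q.rename f) (e.rename f)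
  | loop r p => loop (f r) (p.rename f)

theorem Runs.rename {f : ℕ → ℕ} (hf : Function.Injective f) {p : Prog} {s s' : ℕ → List Bool}
    {t : ℕ} (h : p.Runs s t s') {σ : ℕ → List Bool} (hσ : ∀ r, σ (f r) = s r) :
    ∃ σ', (p.rename f).Runs σ t σ' ∧ (∀ r, σ' (f r) = s' r) ∧
      ∀ k, k ∉ Set.range f → σ' k = σ k := by
  have hupd : ∀ (s σ : ℕ → List Bool), (∀ r, σ (f r) = s r) → ∀ r l,
      (∀ r', Function.update σ (f r) l (f r') = Function.update s r l r') ∧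
      ∀ k, k ∉ Set.range f → Function.update σ (f r) l k = σ k := by
    intro s σ hσ r l
    refine ⟨fun r' => ?_, fun k hk => Function.update_of_ne (fun h => hk ⟨r, h.symm⟩) _ _⟩
    simp [Function.update_apply, hf.eq_iff, hσ]
  induction h generalizing σ with
  | push b r s =>
    exact ⟨_, .push b (f r) σ, by rw [hσ]; exact (hupd s σ hσ r _).1, (hupd s σ hσ r _).2⟩
  | pop r s =>
    exact ⟨_, .pop (f r) σ, by rw [hσ]; exact (hupd s σ hσ r _).1, (hupd s σ hσ r _).2⟩
  | seq _ _ ih ih' =>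
    obtain ⟨σ', h1, h2, h3⟩ := ih hσ
    obtain ⟨σ'', h1', h2', h3'⟩ := ih' h2
    exact ⟨σ'', h1.seq h1', h2', fun k hk => (h3' k hk).trans (h3 k hk)⟩
  | branch_true hr _ ih =>
    obtain ⟨σ', h1, h2, h3⟩ := ih hσ
    exact ⟨σ', .branch_true (by rw [hσ]; exact hr) h1, h2, h3⟩
  | branch_false hr _ ih =>
    obtain ⟨σ', h1, h2, h3⟩ := ih hσ
    exact ⟨σ', .branch_false (by rw [hσ]; exact hr) h1, h2, h3⟩
  | branch_empty hr _ ih =>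
    obtain ⟨σ', h1, h2, h3⟩ := ih hσ
    exact ⟨σ', .branch_empty (by rw [hσ]; exact hr) h1, h2, h3⟩
  | loop_done hr => exact ⟨σ, .loop_done (by rw [hσ]; exact hr), hσ, fun _ _ => rfl⟩
  | loop_step hr _ _ ih ih' =>
    obtain ⟨σ', h1, h2, h3⟩ := ih hσ
    obtain ⟨σ'', h1', h2', h3'⟩ := ih' h2
    exact ⟨σ'', .loop_step (by rw [hσ]; exact hr) h1 h1', h2', fun k hk =>
      (h3' k hk).trans (h3 k hk)⟩

/-- Move a stack of bits onto another one, in reverse order. -/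
def pour (a b : ℕ) : Prog :=
  loop a (branch a (seq (pop a) (push true b)) (seq (pop a) (push false b)) (pop a))

/-- Each bit costs a loop test, a branch test, a pop and a push; the last `1` is the final loop
test. -/
theorem pour_within {a b : ℕ} (hab : a ≠ b) (l : List Bool) (s : ℕ → List Bool) (hl : s a = l) :
    (pour a b).Within s (4 * l.length + 1)
      (Function.update (Function.update s a []) b (l.reverse ++ s b)) := by
  induction l generalizing s with
  | nil =>
    refine (Within.loop_done hl).congr ?_ (by simp)
    funext r
    simp only [Function.update_apply]
    split_ifs <;> simp_all
  | cons x l ih =>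
    have h1 : (branch a (seq (pop a) (push true b)) (seq (pop a) (push false b)) (pop a)).Within s 3
        (Function.update (Function.update s a l) b (x :: s b)) := by
      cases x
      · refine (Within.branch_false (by simp [hl]) ((Within.pop a s).seq (Within.push false b _))
          ).congr ?_ (by simp)
        simp [hl, hab.symm]
      · refine (Within.branch_true (by simp [hl]) ((Within.pop a s).seq (Within.push true b _))
          ).congr ?_ (by simp)
        simp [hl, hab.symm]
    refine (Within.loop_step (by simp [hl]) h1 (ih _ (by simp [hab]))).congr ?_
      (by simp; omega)
    funext r
    simp only [Function.update_apply]
    split_ifs <;> simp_all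

/-- Move a stack of bits onto two other ones, in reverse order. -/
def pourTwo (a b c : ℕ) : Prog :=
  loop a (branch a (seq (pop a) (seq (push true b) (push true c)))
    (seq (pop a) (seq (push false b) (push false c))) (pop a))

theorem pourTwo_within {a b c : ℕ} (hab : a ≠ b) (hac : a ≠ c) (hbc : b ≠ c) (l : List Bool)
    (s : ℕ → List Bool) (hl : s a = l) :
    (pourTwo a b c).Within s (5 * l.length + 1) (Function.update (Function.update
      (Function.update s a []) b (l.reverse ++ s b)) c (l.reverse ++ s c)) := by
  induction l generalizing s with
  | nil =>
    refine (Within.loop_done hl).congr ?_ (by simp)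
    funext r
    simp only [Function.update_apply]
    split_ifs <;> simp_all
  | cons x l ih =>
    have h1 : (branch a (seq (pop a) (seq (push true b) (push true c)))
        (seq (pop a) (seq (push false b) (push false c))) (pop a)).Within s 4
        (Function.update (Function.update (Function.update s a l) b (x :: s b)) c (x :: s c)) := by
      cases x
      · refine (Within.branch_false (by simp [hl]) ((Within.pop a s).seq
          ((Within.push false b _).seq (Within.push false c _)))).congr ?_ (by simp)
        simp [hl, hab.symm, hac.symm, hbc.symm]
      · refine (Within.branch_true (by simp [hl]) ((Within.pop a s).seq
          ((Within.push true b _).seq (Within.push true c _)))).congr ?_ (by simp)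
        simp [hl, hab.symm, hac.symm, hbc.symm]
    refine (Within.loop_step (by simp [hl]) h1 (ih _ (by simp [hab, hac]))).congr ?_
      (by simp; omega)
    funext r
    simp only [Function.update_apply]
    split_ifs <;> simp_all

/-- Copy a stack of ones onto another stack, with an auxiliary stack. -/
def copyOnes (a b aux : ℕ) : Prog := seq (pourTwo a b aux) (pour aux a)

theorem copyOnes_within {a b aux : ℕ} (hab : a ≠ b) (hac : a ≠ aux) (hbc : b ≠ aux) (k : ℕ)
    (s : ℕ → List Bool) (ha : s a = List.replicate k true) (haux : s aux = []) :
    (copyOnes a b aux).Within s (9 * k + 2)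
      (Function.update s b (List.replicate k true ++ s b)) := by
  refine ((pourTwo_within hab hac hbc _ s ha).seq (pour_within hac.symm (List.replicate k true) _
    (by simp [haux]))).congr ?_ (by simp; omega)
  funext r
  simp only [Function.update_apply]
  split_ifs <;> simp_all

/-- Move the ones on top of stack `a` to stack `b`, and remove the end marker from `a`. -/
def moveUnary (a b flag : ℕ) : Prog :=
  seq (push true flag) (loop flag (branch a (seq (pop a) (push true b))
    (seq (pop a) (pop flag)) (pop flag)))

/-- The loop is controlled by a separate one-bit stack, emptied when the end marker is met, because
stack `a` may hold more data behind the marker. -/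
theorem moveUnary_within {a b flag : ℕ} (hab : a ≠ b) (hac : a ≠ flag) (hbc : b ≠ flag) (k : ℕ)
    (l : List Bool) (s : ℕ → List Bool) (ha : s a = unaryBits k ++ l) (hf : s flag = []) :
    (moveUnary a b flag).Within s (4 * k + 6)
      (Function.update (Function.update s a l) b (List.replicate k true ++ s b)) := by
  have h : ∀ k (s : ℕ → List Bool), s a = unaryBits k ++ l → s flag = [true] →
      (loop flag (branch a (seq (pop a) (push true b))
        (seq (pop a) (pop flag)) (pop flag))).Within s (4 * k + 5)
      (Function.update (Function.update (Function.update s flag []) a l) b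
        (List.replicate k true ++ s b)) := by
    intro k
    induction k with
    | zero =>
      intro s ha hf
      have ha' : s a = false :: l := by simpa [unaryBits] using ha
      refine (Within.loop_step (by simp [hf]) (Within.branch_false (by simp [ha'])
        ((Within.pop a s).seq (Within.pop flag _))) (Within.loop_done (by simp [hf, hac.symm]))
        ).congr ?_ (by simp)
      funext r
      simp only [Function.update_apply]
      split_ifs <;> simp_all [unaryBits]
    | succ k ih =>
      intro s ha hf
      have ha' : s a = true :: (unaryBits k ++ l) := by
        simpa [unaryBits, List.replicate_succ] using ha
      refine (Within.loop_step (by simp [hf]) (Within.branch_true (by simp [ha'])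
        ((Within.pop a s).seq (Within.push true b _))) (ih _ (by simp [ha', hab])
          (by simp [hf, hac.symm, hbc.symm]))).congr ?_ (by omega)
      funext r
      simp only [Function.update_apply]
      split_ifs <;> simp_all [List.replicate_succ']
  refine ((Within.push true flag s).seq (h k _ (by simp [ha, hac]) (by simp [hf]))).congr ?_
    (by omega)
  funext r
  simp only [Function.update_apply]
  split_ifs <;> simp_all

end Prog

/-! ### Programs that invert and shift descriptions of gates -/

namespace Prog

theorem length_unaryBits (k : ℕ) : (unaryBits k).length = k + 1 := by simp [unaryBits]

theorem replicate_append_replicate_comm (k w : ℕ) (l : List Bool) :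
    List.replicate k true ++ (List.replicate w true ++ l) =
      List.replicate w true ++ (List.replicate k true ++ l) := by
  simp only [← List.append_assoc, List.replicate_append_replicate, Nat.add_comm]

/-! The programs below use stack `22` for the input circuit `V`, stack `23` for the input
circuit `R`, stack `1` for the output, which is built from its end, stack `5` for the number of
wires of `V` in unary, and the stacks `8`, `10` and `11` as auxiliary ones. -/

/-- Write the inverse of a gate with one wire; `x`, `y` are its tag bits. -/
def invSingle (x y : Bool) : Prog :=
  seq (push false 1) (seq (moveUnary 22 1 10) (seq (push y 1) (push x 1)))

theorem invSingle_within (x y : Bool) (k : ℕ) (l : List Bool) (s : ℕ → List Bool)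
    (h22 : s 22 = unaryBits k ++ l) (h10 : s 10 = []) :
    (invSingle x y).Within s (4 * k + 9)
      (Function.update (Function.update s 22 l) 1 (x :: y :: (unaryBits k ++ s 1))) := by
  refine ((Within.push false 1 s).seq ((moveUnary_within (by decide) (by decide) (by decide) k l _
    (by simp [h22]) (by simp [h10])).seq
    ((Within.push y 1 _).seq (Within.push x 1 _)))).congr ?_ (by omega)
  funext r
  simp [Function.update_apply]; split_ifs <;> simp_all [unaryBits]

/-- Write a controlled NOT. -/
def invCnot : Prog :=
  seq (moveUnary 22 8 10) (seq (push false 1) (seq (moveUnary 22 1 10) (seq (push false 1)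
    (seq (pour 8 1) (seq (push true 1) (push true 1))))))

theorem invCnot_within (i j : ℕ) (l : List Bool) (s : ℕ → List Bool)
    (h22 : s 22 = unaryBits i ++ (unaryBits j ++ l)) (h8 : s 8 = []) (h10 : s 10 = []) :
    invCnot.Within s (8 * i + 4 * j + 17) (Function.update (Function.update s 22 l) 1
      (true :: true :: (unaryBits i ++ (unaryBits j ++ s 1)))) := by
  refine ((moveUnary_within (by decide) (by decide) (by decide) i _ s h22 h10).seq
    ((Within.push false 1 _).seq ((moveUnary_within (by decide) (by decide) (by decide) j l _
      (by simp) (by simp [h10])).seq ((Within.push false 1 _).seq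
    ((pour_within (by decide) (List.replicate i true) _ (by simp [h8])).seq
      ((Within.push true 1 _).seq (Within.push true 1 _))))))).congr ?_ (by simp; omega)
  funext r
  simp [Function.update_apply]; split_ifs <;> simp_all [unaryBits]

/-- Move a gate from stack `22` to stack `1`, inverting it. -/
def invGate : Prog :=
  branch 22
    (seq (pop 22) (branch 22 (seq (pop 22) invCnot) (seq (pop 22) (invSingle false true)) (pop 22)))
    (seq (pop 22) (branch 22 (seq (pop 22) (invSingle true false))
      (seq (pop 22) (invSingle false false)) (pop 22)))
    (pop 22)

theorem invGate_within {w : ℕ} (g : Gate w) (l : List Bool) (s : ℕ → List Bool)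
    (h22 : s 22 = g.encode ++ l) (h8 : s 8 = []) (h10 : s 10 = []) :
    invGate.Within s (8 * g.encode.length) (Function.update (Function.update s 22 l) 1
      (g.inv.encode ++ s 1)) := by
  cases g with
  | had i =>
    refine (Within.branch_false (by simp [h22, Gate.encode]) ((Within.pop 22 s).seq
      (Within.branch_false (by simp [h22, Gate.encode]) ((Within.pop 22 _).seq
      (invSingle_within _ _ i l _ (by simp [h22, Gate.encode]) (by simp [h10])))))).congr ?_
      (by simp [Gate.encode, length_unaryBits]; omega)
    funext r
    simp [Function.update_apply]; split_ifs <;> simp_all [Gate.encode, Gate.inv]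
  | tee i =>
    refine (Within.branch_false (by simp [h22, Gate.encode]) ((Within.pop 22 s).seq
      (Within.branch_true (by simp [h22, Gate.encode]) ((Within.pop 22 _).seq
      (invSingle_within _ _ i l _ (by simp [h22, Gate.encode]) (by simp [h10])))))).congr ?_
      (by simp [Gate.encode, length_unaryBits]; omega)
    funext r
    simp [Function.update_apply]; split_ifs <;> simp_all [Gate.encode, Gate.inv]
  | teeDag i =>
    refine (Within.branch_true (by simp [h22, Gate.encode]) ((Within.pop 22 s).seq
      (Within.branch_false (by simp [h22, Gate.encode]) ((Within.pop 22 _).seq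
      (invSingle_within _ _ i l _ (by simp [h22, Gate.encode]) (by simp [h10])))))).congr ?_
      (by simp [Gate.encode, length_unaryBits]; omega)
    funext r
    simp [Function.update_apply]; split_ifs <;> simp_all [Gate.encode, Gate.inv]
  | cnot i j hij =>
    refine (Within.branch_true (by simp [h22, Gate.encode]) ((Within.pop 22 s).seq
      (Within.branch_true (by simp [h22, Gate.encode]) ((Within.pop 22 _).seq
      (invCnot_within i j l _ (by simp [h22, Gate.encode]) (by simp [h8])
        (by simp [h10])))))).congr ?_
      (by simp [Gate.encode, length_unaryBits]; omega)
    funext r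
    simp [Function.update_apply]; split_ifs <;> simp_all [Gate.encode, Gate.inv]

theorem encode_ne_nil {w : ℕ} (g : Gate w) : g.encode ≠ [] := by
  cases g <;> simp [Gate.encode]

theorem length_encode_pos {w : ℕ} (g : Gate w) : 0 < g.encode.length :=
  List.length_pos_iff.2 (encode_ne_nil g)

/-- Reading gates from the front and writing their inverses in front of the output reverses their
order, as inversion demands. The constant is `9 = 8 + 1`: the loop test is paid for by the nonempty
description of each gate. -/
theorem loop_invGate_within {w : ℕ} (gs : List (Gate w)) (s : ℕ → List Bool)
    (h22 : s 22 = gs.flatMap Gate.encode) (h8 : s 8 = []) (h10 : s 10 = []) :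
    (loop 22 invGate).Within s (9 * (gs.flatMap Gate.encode).length + 1)
      (Function.update (Function.update s 22 []) 1
        ((invGates gs).flatMap Gate.encode ++ s 1)) := by
  induction gs generalizing s with
  | nil =>
    refine (Within.loop_done (by simpa using h22)).congr ?_ (by simp)
    funext r
    simp [Function.update_apply, invGates]; split_ifs <;> simp_all
  | cons g gs ih =>
    have hpos := length_encode_pos g
    refine (Within.loop_step (by simp [h22, encode_ne_nil]) (invGate_within g _ s (by
      simpa using h22) h8 h10) (ih _ (by simp) (by simp [h8]) (by simp [h10]))).congr ?_
      (by simp; omega)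
    funext r
    simp [Function.update_apply, invGates]; split_ifs <;> simp_all

/-- Copy the index of a wire from stack `23` to stack `8`, shifting and reversing it. -/
def shiftUnary : Prog := seq (copyOnes 5 8 11) (seq (moveUnary 23 8 10) (push false 8))

theorem shiftUnary_within (w k : ℕ) (l : List Bool) (s : ℕ → List Bool)
    (h23 : s 23 = unaryBits k ++ l) (h5 : s 5 = List.replicate w true) (h10 : s 10 = [])
    (h11 : s 11 = []) :
    shiftUnary.Within s (9 * w + 4 * k + 9) (Function.update (Function.update s 23 l) 8
      ((unaryBits (w + k)).reverse ++ s 8)) := by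
  refine ((copyOnes_within (by decide) (by decide) (by decide) w s h5 h11).seq
    ((moveUnary_within (by decide) (by decide) (by decide) k l _ (by simp [h23])
      (by simp [h10])).seq (Within.push false 8 _))).congr ?_ (by omega)
  have hc := replicate_append_replicate_comm k w (s 8)
  funext r
  simp [Function.update_apply]; split_ifs <;>
    simp_all [unaryBits, ← List.replicate_append_replicate]

/-- Move a gate from stack `23` to stack `8`, shifting and reversing it. -/
def shiftGate : Prog :=
  branch 23
    (seq (pop 23) (seq (push true 8) (branch 23
      (seq (pop 23) (seq (push true 8) (seq shiftUnary shiftUnary)))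
      (seq (pop 23) (seq (push false 8) shiftUnary)) (pop 23))))
    (seq (pop 23) (seq (push false 8) (branch 23
      (seq (pop 23) (seq (push true 8) shiftUnary))
      (seq (pop 23) (seq (push false 8) shiftUnary)) (pop 23))))
    (pop 23)

theorem shiftGate_within (w : ℕ) {w' : ℕ} (g : Gate w') (l : List Bool) (s : ℕ → List Bool)
    (h23 : s 23 = g.encode ++ l) (h5 : s 5 = List.replicate w true) (h10 : s 10 = [])
    (h11 : s 11 = []) :
    shiftGate.Within s (18 * (w + 1) * g.encode.length) (Function.update (Function.update s 23 l) 8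
      ((g.map (Fin.natAdd w) (Fin.natAdd_injective w' w)).encode.reverse ++ s 8)) := by
  cases g with
  | had i =>
    refine (Within.branch_false (by simp [h23, Gate.encode]) ((Within.pop 23 s).seq
      ((Within.push false 8 _).seq (Within.branch_false (by simp [h23, Gate.encode])
      ((Within.pop 23 _).seq ((Within.push false 8 _).seq
      (shiftUnary_within w i l _ (by simp [h23, Gate.encode]) (by simp [h5]) (by simp [h10])
        (by simp [h11])))))))).congr ?_ (by
          simp [Gate.encode, length_unaryBits]; nlinarith)
    funext r
    simp [Function.update_apply]; split_ifs <;> simp_all [Gate.encode, Gate.map]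
  | tee i =>
    refine (Within.branch_false (by simp [h23, Gate.encode]) ((Within.pop 23 s).seq
      ((Within.push false 8 _).seq (Within.branch_true (by simp [h23, Gate.encode])
      ((Within.pop 23 _).seq ((Within.push true 8 _).seq
      (shiftUnary_within w i l _ (by simp [h23, Gate.encode]) (by simp [h5]) (by simp [h10])
        (by simp [h11])))))))).congr ?_ (by
          simp [Gate.encode, length_unaryBits]; nlinarith)
    funext r
    simp [Function.update_apply]; split_ifs <;> simp_all [Gate.encode, Gate.map]
  | teeDag i =>
    refine (Within.branch_true (by simp [h23, Gate.encode]) ((Within.pop 23 s).seq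
      ((Within.push true 8 _).seq (Within.branch_false (by simp [h23, Gate.encode])
      ((Within.pop 23 _).seq ((Within.push false 8 _).seq
      (shiftUnary_within w i l _ (by simp [h23, Gate.encode]) (by simp [h5]) (by simp [h10])
        (by simp [h11])))))))).congr ?_ (by
          simp [Gate.encode, length_unaryBits]; nlinarith)
    funext r
    simp [Function.update_apply]; split_ifs <;> simp_all [Gate.encode, Gate.map]
  | cnot i j hij =>
    refine (Within.branch_true (by simp [h23, Gate.encode]) ((Within.pop 23 s).seq
      ((Within.push true 8 _).seq (Within.branch_true (by simp [h23, Gate.encode])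
      ((Within.pop 23 _).seq ((Within.push true 8 _).seq
      ((shiftUnary_within w i (unaryBits j ++ l) _ (by simp [h23, Gate.encode]) (by simp [h5])
        (by simp [h10]) (by simp [h11])).seq
      (shiftUnary_within w j l _ (by simp) (by simp [h5]) (by simp [h10])
        (by simp [h11]))))))))).congr ?_ (by
          simp [Gate.encode, length_unaryBits]; nlinarith)
    funext r
    simp [Function.update_apply]; split_ifs <;> simp_all [Gate.encode, Gate.map]

/-- The order of these gates must be kept, so they are collected reversed on stack `8`; pouring that
stack onto the output reverses them back. -/
theorem loop_shiftGate_within (w : ℕ) {w' : ℕ} (gs : List (Gate w')) (s : ℕ → List Bool)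
    (h23 : s 23 = gs.flatMap Gate.encode) (h5 : s 5 = List.replicate w true) (h10 : s 10 = [])
    (h11 : s 11 = []) :
    (loop 23 shiftGate).Within s (19 * (w + 1) * (gs.flatMap Gate.encode).length + 1)
      (Function.update (Function.update s 23 []) 8
        (((rightGates w gs).flatMap Gate.encode).reverse ++ s 8)) := by
  induction gs generalizing s with
  | nil =>
    refine (Within.loop_done (by simpa using h23)).congr ?_ (by simp)
    funext r
    simp [Function.update_apply, rightGates]; split_ifs <;> simp_all
  | cons g gs ih =>
    have hpos := length_encode_pos g
    refine (Within.loop_step (by simp [h23, encode_ne_nil]) (shiftGate_within w g _ s (by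
      simpa using h23) h5 h10 h11) (ih _ (by simp) (by simp [h5]) (by simp [h10])
      (by simp [h11]))).congr ?_ (by simp; nlinarith)
    funext r
    simp [Function.update_apply, rightGates]; split_ifs <;> simp_all

end Prog

/-! ### Programs that write the swaps and assemble the attack -/

namespace Prog

/-- Write the index `w + i`, where `w` is on stack `5` and `i` on stack `12`. -/
def writeShifted : Prog := seq (push false 1) (seq (copyOnes 12 1 11) (copyOnes 5 1 11))

theorem writeShifted_within (w i : ℕ) (s : ℕ → List Bool) (h5 : s 5 = List.replicate w true)
    (h12 : s 12 = List.replicate i true) (h11 : s 11 = []) :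
    writeShifted.Within s (9 * w + 9 * i + 5)
      (Function.update s 1 (unaryBits (w + i) ++ s 1)) := by
  refine ((Within.push false 1 s).seq ((copyOnes_within (by decide) (by decide) (by decide) i _
    (by simp [h12]) (by simp [h11])).seq (copyOnes_within (by decide) (by decide) (by decide) w _
    (by simp [h5]) (by simp [h11])))).congr ?_ (by omega)
  funext r
  simp [Function.update_apply]; split_ifs <;>
    simp_all [unaryBits, ← List.replicate_append_replicate]

/-- Write the index `i + 1`, where `i` is on stack `12`. -/
def writeSucc : Prog := seq (push false 1) (seq (copyOnes 12 1 11) (push true 1))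

theorem writeSucc_within (i : ℕ) (s : ℕ → List Bool) (h12 : s 12 = List.replicate i true)
    (h11 : s 11 = []) :
    writeSucc.Within s (9 * i + 4) (Function.update s 1 (unaryBits (i + 1) ++ s 1)) := by
  refine ((Within.push false 1 s).seq ((copyOnes_within (by decide) (by decide) (by decide) i _
    (by simp [h12]) (by simp [h11])).seq (Within.push true 1 _))).congr ?_ (by omega)
  funext r
  simp [Function.update_apply]; split_ifs <;> simp_all [unaryBits, List.replicate_succ]

/-- Write the tag of a controlled NOT. -/
def writeTag : Prog := seq (push true 1) (push true 1)

theorem writeTag_within (s : ℕ → List Bool) :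
    writeTag.Within s 2 (Function.update s 1 (true :: true :: s 1)) := by
  refine ((Within.push true 1 s).seq (Within.push true 1 _)).congr ?_ (by omega)
  simp

/-- The description of a controlled NOT with control `i` and target `j`. -/
def cnotBits (i j : ℕ) : List Bool := [true, true] ++ unaryBits i ++ unaryBits j

/-- The description of the gates that swap the wires `i + 1` and `w + i`, for all `i < k`. -/
def swapBits (w : ℕ) : ℕ → List Bool
  | 0 => []
  | i + 1 => cnotBits (i + 1) (w + i) ++ (cnotBits (w + i) (i + 1) ++
      (cnotBits (i + 1) (w + i) ++ swapBits w i))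

/-- Write the gates that swap two wires. -/
def writeSwap : Prog :=
  seq (pop 4) (seq (seq writeShifted (seq writeSucc writeTag))
    (seq (seq writeSucc (seq writeShifted writeTag))
      (seq (seq writeShifted (seq writeSucc writeTag)) (push true 12))))

theorem writeSwap_within (w i : ℕ) (s : ℕ → List Bool) (h5 : s 5 = List.replicate w true)
    (h12 : s 12 = List.replicate i true) (h11 : s 11 = []) :
    writeSwap.Within s (27 * w + 54 * i + 35)
      (Function.update (Function.update (Function.update s 4 (s 4).tail) 12
        (List.replicate (i + 1) true)) 1
        (cnotBits (i + 1) (w + i) ++ (cnotBits (w + i) (i + 1) ++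
          (cnotBits (i + 1) (w + i) ++ s 1)))) := by
  have h1 : ∀ s : ℕ → List Bool, s 5 = List.replicate w true → s 12 = List.replicate i true →
      s 11 = [] → (seq writeShifted (seq writeSucc writeTag)).Within s (9 * w + 18 * i + 11)
        (Function.update s 1 (cnotBits (i + 1) (w + i) ++ s 1)) := by
    intro s h5 h12 h11
    refine ((writeShifted_within w i s h5 h12 h11).seq ((writeSucc_within i _ (by simp [h12])
      (by simp [h11])).seq (writeTag_within _))).congr ?_ (by omega)
    simp [cnotBits]
  have h2 : ∀ s : ℕ → List Bool, s 5 = List.replicate w true → s 12 = List.replicate i true →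
      s 11 = [] → (seq writeSucc (seq writeShifted writeTag)).Within s (9 * w + 18 * i + 11)
        (Function.update s 1 (cnotBits (w + i) (i + 1) ++ s 1)) := by
    intro s h5 h12 h11
    refine ((writeSucc_within i s h12 h11).seq ((writeShifted_within w i _ (by simp [h5])
      (by simp [h12]) (by simp [h11])).seq (writeTag_within _))).congr ?_ (by omega)
    simp [cnotBits]
  refine ((Within.pop 4 s).seq ((h1 _ (by simp [h5]) (by simp [h12]) (by simp [h11])).seq
    ((h2 _ (by simp [h5]) (by simp [h12]) (by simp [h11])).seq
    ((h1 _ (by simp [h5]) (by simp [h12]) (by simp [h11])).seq (Within.push true 12 _))))).congr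
    ?_ (by omega)
  funext r
  simp [Function.update_apply]; split_ifs <;> simp_all [List.replicate_succ]

/-- Stack `4` counts the remaining pairs and stack `12` holds the index of the current one. As the
output grows at its front, rising indices produce the list in which the last pair comes first, the
order of `swapAll`. -/
theorem loop_writeSwap_within (w k i : ℕ) (o : List Bool) (s : ℕ → List Bool)
    (h4 : s 4 = List.replicate k true) (h5 : s 5 = List.replicate w true)
    (h12 : s 12 = List.replicate i true) (h11 : s 11 = []) (h1 : s 1 = swapBits w i ++ o) :
    (loop 4 writeSwap).Within s ((27 * w + 54 * (i + k) + 36) * k + 1)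
      (Function.update (Function.update (Function.update s 4 []) 12
        (List.replicate (i + k) true)) 1 (swapBits w (i + k) ++ o)) := by
  induction k generalizing s i with
  | zero =>
    refine (Within.loop_done (by simpa using h4)).congr ?_ (by simp)
    funext r
    simp [Function.update_apply]; split_ifs <;> simp_all
  | succ k ih =>
    have hk : i + 1 + k = i + (k + 1) := by omega
    refine (Within.loop_step (by simp [h4, List.replicate_succ]) (writeSwap_within w i s h5 h12 h11)
      (ih (i + 1) _ (by simp [h4]) (by simp [h5]) (by simp) (by simp [h11])
        (by simp [h1, swapBits]))).congr ?_ (by rw [hk]; nlinarith)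
    rw [hk]
    funext r
    simp [Function.update_apply]; split_ifs <;> simp_all

/-- Split the description of the circuit on stack `22` into its parts. -/
def readFirst : Prog :=
  seq (moveUnary 22 2 10) (seq (moveUnary 22 3 10) (seq (moveUnary 22 4 10) (seq (pop 4)
    (seq (moveUnary 22 5 10) (seq (pourTwo 22 8 9) (pour 8 22))))))

/-- The output of the verifier includes the reject flag, and one pop on stack `4` reduces `m + 1` to
the number of message wires. The gates are needed twice: stack `22` keeps them for inversion, stack
`9` a reversed copy for the forward run. -/
theorem readFirst_within (c v m w : ℕ) (l : List Bool) (s : ℕ → List Bool)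
    (h22 : s 22 = unaryBits c ++ (unaryBits v ++ (unaryBits (m + 1) ++ (unaryBits w ++ l))))
    (hs : ∀ i, 0 < i → i < 20 → s i = []) :
    readFirst.Within s (40 + 9 * (s 22).length)
      (Function.update (Function.update (Function.update (Function.update (Function.update
        (Function.update s 2 (List.replicate c true)) 3 (List.replicate v true))
          4 (List.replicate m true)) 5 (List.replicate w true)) 9 l.reverse) 22 l) := by
  have h2 := hs 2 (by decide) (by decide)
  have h3 := hs 3 (by decide) (by decide)
  have h4 := hs 4 (by decide) (by decide)
  have h5 := hs 5 (by decide) (by decide)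
  have h8 := hs 8 (by decide) (by decide)
  have h9 := hs 9 (by decide) (by decide)
  have h10 := hs 10 (by decide) (by decide)
  refine ((moveUnary_within (by decide) (by decide) (by decide) c _ s h22 h10).seq
    ((moveUnary_within (by decide) (by decide) (by decide) v
      (unaryBits (m + 1) ++ (unaryBits w ++ l)) _ (by simp) (by simp [h10])).seq
    ((moveUnary_within (by decide) (by decide) (by decide) (m + 1) (unaryBits w ++ l) _ (by simp)
      (by simp [h10])).seq ((Within.pop 4 _).seq
    ((moveUnary_within (by decide) (by decide) (by decide) w l _ (by simp) (by simp [h10])).seq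
    ((pourTwo_within (by decide) (by decide) (by decide) l _ (by simp)).seq
    (pour_within (by decide) l.reverse _ (by simp [h8])))))))).congr ?_
    (by simp [h22, length_unaryBits]; omega)
  funext r
  simp [Function.update_apply, h2, h3, h4, h5, h8, h9]; split_ifs <;> simp_all

/-- Split the description of the circuit on stack `23` into its parts. -/
def readSecond : Prog :=
  seq (pop 23) (seq (pop 23) (seq (moveUnary 23 6 10) (moveUnary 23 7 10)))

/-- The circuit on stack `23` has no input, so its first two numbers consist of their end markers
only and two pops remove them. -/
theorem readSecond_within (m w : ℕ) (l : List Bool) (s : ℕ → List Bool)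
    (h23 : s 23 = unaryBits 0 ++ (unaryBits 0 ++ (unaryBits m ++ (unaryBits w ++ l))))
    (h6 : s 6 = []) (h7 : s 7 = []) (h10 : s 10 = []) :
    readSecond.Within s (20 + 4 * (s 23).length)
      (Function.update (Function.update (Function.update s 6 (List.replicate m true))
        7 (List.replicate w true)) 23 l) := by
  refine ((Within.pop 23 _).seq ((Within.pop 23 _).seq
    ((moveUnary_within (by decide) (by decide) (by decide) m (unaryBits w ++ l) _
      (by simp [h23, unaryBits]) (by simp [h10])).seq
    (moveUnary_within (by decide) (by decide) (by decide) w l _ (by simp)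
      (by simp [h10]))))).congr ?_ (by simp [h23, length_unaryBits]; omega)
  funext r
  simp [Function.update_apply, h6, h7]; split_ifs <;> simp_all

/-- Write the number of wires, the number of output qubits, and the input lengths. -/
def writeHeaders : Prog :=
  seq (push false 1) (seq (pour 7 1) (seq (pour 5 1) (seq (push false 1) (seq (copyOnes 2 1 11)
    (seq (push false 1) (seq (pour 3 1) (seq (push false 1) (pour 2 1))))))))

/-- The number `c` is written twice, as input and output length of the attack, hence the copy before
the pour. Pouring two stacks of ones in succession adds the numbers of wires. -/
theorem writeHeaders_within (c v w w' : ℕ) (s : ℕ → List Bool) (h2 : s 2 = List.replicate c true)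
    (h3 : s 3 = List.replicate v true) (h5 : s 5 = List.replicate w true)
    (h7 : s 7 = List.replicate w' true) (h11 : s 11 = []) :
    ∃ s', writeHeaders.Within s (13 * (c + v + w + w') + 20) s' ∧
      s' 1 = unaryBits c ++ (unaryBits v ++ (unaryBits c ++ (unaryBits (w + w') ++ s 1))) := by
  refine ⟨_, ((Within.push false 1 s).seq
    ((pour_within (by decide) (List.replicate w' true) _ (by simp [h7])).seq
    ((pour_within (by decide) (List.replicate w true) _ (by simp [h5])).seq
    ((Within.push false 1 _).seq
    ((copyOnes_within (by decide) (by decide) (by decide) c _ (by simp [h2]) (by simp [h11])).seq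
    ((Within.push false 1 _).seq
    ((pour_within (by decide) (List.replicate v true) _ (by simp [h3])).seq
    ((Within.push false 1 _).seq
    (pour_within (by decide) (List.replicate c true) _ (by simp [h2])))))))))).congr rfl
    (by simp; omega), ?_⟩
  simp [unaryBits, ← List.replicate_append_replicate]

/-- A gate has at most two wire indices, so shifting adds at most `2 * w` bits to a nonempty
description. -/
theorem length_rightGates_le (w : ℕ) {w' : ℕ} (gs : List (Gate w')) :
    ((rightGates w gs).flatMap Gate.encode).length ≤
      (2 * w + 1) * (gs.flatMap Gate.encode).length := by
  induction gs with
  | nil => simp [rightGates]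
  | cons g gs ih =>
    have h : (g.map (Fin.natAdd w) (Fin.natAdd_injective w' w)).encode.length ≤
        (2 * w + 1) * g.encode.length := by
      cases g <;> simp [Gate.map, Gate.encode, length_unaryBits] <;> nlinarith
    have h2 : rightGates w (g :: gs) =
        g.map (Fin.natAdd w) (Fin.natAdd_injective w' w) :: rightGates w gs := rfl
    rw [h2, List.flatMap_cons, List.flatMap_cons, List.length_append, List.length_append, mul_add]
    omega

/-- Turn the descriptions of `V` and `R` into that of `attackCircuit V R`. -/
def buildAttack : Prog :=
  seq readFirst (seq readSecond (seq (loop 22 invGate) (seq (loop 4 writeSwap)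
    (seq (loop 23 shiftGate) (seq (pour 8 1) (seq (pour 9 1) writeHeaders))))))

theorem buildAttack_within (c v m w w' : ℕ) (gA : List (Gate w)) (gB : List (Gate w'))
    (s : ℕ → List Bool)
    (h22 : s 22 = unaryBits c ++ (unaryBits v ++ (unaryBits (m + 1) ++ (unaryBits w ++
      gA.flatMap Gate.encode))))
    (h23 : s 23 = unaryBits 0 ++ (unaryBits 0 ++ (unaryBits m ++ (unaryBits w' ++
      gB.flatMap Gate.encode))))
    (hs : ∀ i, 0 < i → i < 20 → s i = []) :
    ∃ s', buildAttack.Within s (1000 * ((s 22).length + (s 23).length) ^ 2) s' ∧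
      s' 1 = unaryBits c ++ (unaryBits v ++ (unaryBits c ++ (unaryBits (w + w') ++
        (gA.flatMap Gate.encode ++ ((rightGates w gB).flatMap Gate.encode ++
          (swapBits w m ++ (invGates gA).flatMap Gate.encode)))))) := by
  have h1 := hs 1 (by decide) (by decide)
  have h6 := hs 6 (by decide) (by decide)
  have h7 := hs 7 (by decide) (by decide)
  have h8 := hs 8 (by decide) (by decide)
  have h10 := hs 10 (by decide) (by decide)
  have h11 := hs 11 (by decide) (by decide)
  have h12 := hs 12 (by decide) (by decide)
  have r1 := readFirst_within c v m w _ s h22 hs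
  generalize hs1 : Function.update _ 22 _ = s1 at r1
  have r2 := readSecond_within m w' _ s1 (by simp [← hs1, h23]; rfl) (by simp [← hs1, h6])
    (by simp [← hs1, h7]) (by simp [← hs1, h10])
  generalize hs2 : Function.update _ 23 _ = s2 at r2
  have r3 := loop_invGate_within gA s2 (by simp [← hs2, ← hs1]) (by simp [← hs2, ← hs1, h8])
    (by simp [← hs2, ← hs1, h10])
  generalize hs3 : Function.update _ 1 _ = s3 at r3
  have r4 := loop_writeSwap_within w m 0 ((invGates gA).flatMap Gate.encode) s3
    (by simp [← hs3, ← hs2, ← hs1]) (by simp [← hs3, ← hs2, ← hs1])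
    (by simp [← hs3, ← hs2, ← hs1, h12]) (by simp [← hs3, ← hs2, ← hs1, h11])
    (by simp [← hs3, ← hs2, ← hs1, h1, swapBits])
  generalize hs4 : Function.update _ 1 _ = s4 at r4
  have r5 := loop_shiftGate_within w gB s4 (by simp [← hs4, ← hs3, ← hs2])
    (by simp [← hs4, ← hs3, ← hs2, ← hs1]) (by simp [← hs4, ← hs3, ← hs2, ← hs1, h10])
    (by simp [← hs4, ← hs3, ← hs2, ← hs1, h11])
  generalize hs5 : Function.update _ 8 _ = s5 at r5
  have r6 := pour_within (a := 8) (b := 1) (by decide)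
    ((rightGates w gB).flatMap Gate.encode).reverse s5
    (by simp [← hs5, ← hs4, ← hs3, ← hs2, ← hs1, h8])
  generalize hs6 : Function.update _ 1 _ = s6 at r6
  have r7 := pour_within (a := 9) (b := 1) (by decide) (gA.flatMap Gate.encode).reverse s6
    (by simp [← hs6, ← hs5, ← hs4, ← hs3, ← hs2, ← hs1])
  generalize hs7 : Function.update _ 1 _ = s7 at r7
  obtain ⟨s8, r8, h8'⟩ := writeHeaders_within c v w w' s7
    (by simp [← hs7, ← hs6, ← hs5, ← hs4, ← hs3, ← hs2, ← hs1])
    (by simp [← hs7, ← hs6, ← hs5, ← hs4, ← hs3, ← hs2, ← hs1])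
    (by simp [← hs7, ← hs6, ← hs5, ← hs4, ← hs3, ← hs2, ← hs1])
    (by simp [← hs7, ← hs6, ← hs5, ← hs4, ← hs3, ← hs2])
    (by simp [← hs7, ← hs6, ← hs5, ← hs4, ← hs3, ← hs2, ← hs1, h11])
  refine ⟨s8, (r1.seq (r2.seq (r3.seq (r4.seq (r5.seq (r6.seq (r7.seq r8))))))).congr rfl ?_, ?_⟩
  · have hB := length_rightGates_le w gB
    have h23' : s1 23 = s 23 := by simp [← hs1]
    have ha : (s 22).length = c + v + m + w + 5 + (gA.flatMap Gate.encode).length := by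
      simp only [h22, List.length_append, length_unaryBits]; omega
    have hb : (s 23).length = m + w' + 4 + (gB.flatMap Gate.encode).length := by
      simp only [h23, List.length_append, length_unaryBits]; omega
    rw [h23']
    simp only [List.length_reverse, zero_add]
    generalize (s 22).length = a at ha ⊢
    generalize (s 23).length = b at hb ⊢
    generalize (gA.flatMap Gate.encode).length = x at ha ⊢
    generalize (gB.flatMap Gate.encode).length = y at hb hB ⊢
    generalize ((rightGates w gB).flatMap Gate.encode).length = z at hB ⊢
    -- Every parameter is at most the total input length `N`, so the products of two parameters are
    -- bounded by multiples of `N * N`. The end markers give `9 ≤ N`, which absorbs linear and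
    -- constant terms.
    obtain ⟨N, hN⟩ : ∃ N, N = a + b := ⟨_, rfl⟩
    have k1 : (27 * w + 54 * m + 36) * m ≤ (117 * N) * N := Nat.mul_le_mul (by omega) (by omega)
    have k2 : 19 * (w + 1) * y ≤ (38 * N) * N := Nat.mul_le_mul (by omega) (by omega)
    have k3 : (2 * w + 1) * y ≤ (3 * N) * N := Nat.mul_le_mul (by omega) (by omega)
    have k4 : 9 * N ≤ N * N := Nat.mul_le_mul (by omega) le_rfl
    rw [← hN]
    nlinarith
  · rw [h8', ← hs7, ← hs6, ← hs5, ← hs4]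
    simp

end Prog

/-! ### The attack is efficient -/

theorem encode_leftGates {w : ℕ} (w' : ℕ) (l : List (Gate w)) :
    (leftGates w' l).flatMap Gate.encode = l.flatMap Gate.encode := by
  rw [leftGates, List.flatMap_map]
  congr 1
  funext g
  cases g <;> rfl

/-- The message occupies the wires from `1` on, behind the flag, and the output of `R` those from
`w` on; this explains the indices in `Prog.swapBits`. -/
theorem encode_swapAll {w W : ℕ} : ∀ {m : ℕ} (α β : Fin m → Fin W) (h)
    (_ : ∀ i, (α i : ℕ) = i + 1) (_ : ∀ i, (β i : ℕ) = w + i),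
    (swapAll α β h).flatMap Gate.encode = Prog.swapBits w m
  | 0, _, _, _, _, _ => rfl
  | m + 1, α, β, h, hα, hβ => by
    have ih := encode_swapAll (w := w) (fun i => α i.castSucc) (fun i => β i.castSucc) (fun _ => h _)
      (fun i => by simp [hα]) (fun i => by simp [hβ])
    simp [swapAll, swapGates, Gate.encode, Prog.swapBits, Prog.cnotBits, hα, hβ, ih]

theorem encode_attackCircuit {c k' m : ℕ} (V : QCircuit c k' (m + 1)) (R : QCircuit 0 0 m) :
    (attackCircuit V R).encode = unaryBits c ++ (unaryBits k' ++ (unaryBits c ++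
      (unaryBits (V.wires + R.wires) ++ (V.gates.flatMap Gate.encode ++
        ((rightGates V.wires R.gates).flatMap Gate.encode ++ (Prog.swapBits V.wires m ++
          (invGates V.gates).flatMap Gate.encode)))))) := by
  simp only [QCircuit.encode, attackCircuit, List.flatMap_append, encode_leftGates,
    List.append_assoc]
  rw [encode_swapAll (w := V.wires) _ _ _ (fun i => by simp [messageWire]) (fun i => by simp)]

/-- Functions of two polynomial-time computable strings, computed in polynomial time by a program
that finds its inputs on the stacks `22` and `23`. -/
theorem PolyTimeComputable.comp_two {f g h : ℕ → List Bool} (hf : PolyTimeComputable f)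
    (hg : PolyTimeComputable g) (p : Prog) (Q : Polynomial ℕ)
    (hp : ∀ n (s : ℕ → List Bool), s 22 = f n → s 23 = g n → (∀ i, i < 20 → s i = []) →
      ∃ s', p.Within s (Q.eval ((s 22).length + (s 23).length)) s' ∧ s' 1 = h n) :
    PolyTimeComputable h := by
  obtain ⟨pf, Tf, hf⟩ := hf
  obtain ⟨pg, Tg, hg⟩ := hg
  -- The two programs run on the even and the odd stacks from `20` on. They cannot interfere, their
  -- output stack `1` becomes `22` and `23`, and the stacks below `20` remain empty for `p`.
  have injf : Function.Injective fun r : ℕ => 2 * r + 20 := fun a b h => by simpa using h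
  have injg : Function.Injective fun r : ℕ => 2 * r + 21 := fun a b h => by simpa using h
  refine ⟨.seq (Prog.pourTwo 0 20 21) (.seq (pf.rename fun r => 2 * r + 20)
    (.seq (pg.rename fun r => 2 * r + 21) p)),
    5 * .X + 1 + Tf + Tg + Q.comp (Tf + Tg), fun n => ?_⟩
  set s0 : ℕ → List Bool := Function.update (fun _ => []) 0 (List.replicate n true) with hs0
  obtain ⟨tf, sf, htf, rf, hf⟩ := hf n
  obtain ⟨tg, sg, htg, rg, hg⟩ := hg n
  obtain ⟨t0, ht0, r0⟩ := Prog.pourTwo_within (a := 0) (b := 20) (c := 21) (by decide) (by decide)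
    (by decide) (List.replicate n true) s0 (by simp [s0])
  generalize hs1 : Function.update _ 21 _ = s1 at r0
  obtain ⟨s2, r1, h2, h2'⟩ := rf.rename injf (σ := s1) (fun r => by
    rcases Nat.eq_zero_or_pos r with rfl | hr
    · simp [← hs1, hs0]
    · have e1 : 2 * r + 20 ≠ 21 := by omega
      simp [← hs1, hs0, e1, hr.ne'])
  obtain ⟨s3, r2, h3, h3'⟩ := rg.rename injg (σ := s2) (fun r => by
    rw [h2' _ (by rintro ⟨a, ha⟩; dsimp only at ha; omega)]
    rcases Nat.eq_zero_or_pos r with rfl | hr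
    · simp [← hs1, hs0]
    · have e1 : 2 * r + 21 ≠ 20 := by omega
      simp [← hs1, hs0, e1, hr.ne'])
  have e22 : s3 22 = f n := by
    rw [h3' _ (by rintro ⟨a, ha⟩; dsimp only at ha; omega), ← hf, ← h2 1]
  have e23 : s3 23 = g n := by rw [← hg, ← h3 1]
  obtain ⟨s4, ⟨t3, ht3, r3⟩, h4⟩ := hp n s3 e22 e23 (fun i hi => by
    rw [h3' _ (by rintro ⟨a, ha⟩; dsimp only at ha; omega),
      h2' _ (by rintro ⟨a, ha⟩; dsimp only at ha; omega), ← hs1]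
    simp [hs0, hi.ne, (show i ≠ 21 by omega)])
  refine ⟨_, s4, ?_, r0.seq (r1.seq (r2.seq r3)), h4⟩
  -- The output stack is empty at the start, so the output is no longer than the running time.
  have l1 := rf.length_le 1
  have l2 := rg.length_le 1
  simp only [ne_eq, one_ne_zero, not_false_eq_true, Function.update_of_ne, List.length_nil,
    zero_add, hf, hg] at l1 l2
  -- A polynomial with natural coefficients is monotone.
  have hQ : Q.eval ((s3 22).length + (s3 23).length) ≤ Q.eval (Tf.eval n + Tg.eval n) := by
    rw [e22, e23, Polynomial.eval_eq_sum, Polynomial.eval_eq_sum]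
    exact Finset.sum_le_sum fun i _ => Nat.mul_le_mul_left _ (Nat.pow_le_pow_left (by omega) _)
  simp only [List.length_replicate] at ht0
  simp only [Polynomial.eval_add, Polynomial.eval_mul, Polynomial.eval_comp, Polynomial.eval_X,
    Polynomial.eval_ofNat, Polynomial.eval_one]
  omega

theorem isQPT_attackCircuit {c k' m : ℕ → ℕ} {V : ∀ n, QCircuit (c n) (k' n) (m n + 1)}
    {R : ∀ n, QCircuit 0 0 (m n)} (hV : IsQPT V) (hR : IsQPT R) :
    IsQPT fun n => attackCircuit (V n) (R n) := by
  refine PolyTimeComputable.comp_two hV hR Prog.buildAttack (1000 * .X ^ 2)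
    fun n s h22 h23 hs => ?_
  have h := Prog.buildAttack_within (c n) (k' n) (m n) (V n).wires (R n).wires (V n).gates
    (R n).gates s (by simpa [QCircuit.encode] using h22) (by simpa [QCircuit.encode] using h23)
    fun i _ hi => hs i hi
  rw [← encode_attackCircuit] at h
  simpa using h

theorem mainTheorem2 (S : QSignature) (hS : S.Correct) (M : S.Measurement) (hM : S.NonTrivial M) :
    ∃ ν : ℕ → ℝ, Negligible ν ∧ ∀ ε : ℕ → ℝ≥0, S.OneTimeSecure ε {M} →
      ∀ n, 1 - ν n ≤ (ε n : ℝ) ∧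
        ((M n).P none none = 0 ∨ (M n).P none none = 1 → 2 - ν n ≤ (ε n : ℝ)) :=
  S.exists_negligible_of_isQPT hS hM fun _ hR => isQPT_attackCircuit S.ver_qpt hR
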